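/- **Setting.** Consider a two-layer composite beam of length $1$ and width $2g_b$ ($g_b>0$): a mechanical substrate occupying the thickness range $[-h_1,h_1]$ and, bonded on top of it, a piezoelectric layer occupying $[h_1,h_2]$, where $0<h_1<h_2$. Let $\rho^p,\rho^s>0$ be the mass densities, $C^p,C^s>0$ the stiffness coefficients ($p$ = piezoelectric layer, $s$ = substrate), $\epsilon_{33}>0$ the permittivity, $\mu>0$ the magnetic permeability, and $\gamma\in\mathbb R$ the piezoelectric coupling coefficient. For a layer $[h_a,h_b]$ put $A=2g_b(h_b-h_a)$, $I=\tfrac23 g_b(h_b^3-h_a^3)$, $I_0=g_b(h_b^2-h_a^2)$, with superscripts $p,s$ for the two layers (so $I_0^s=0$), and $$\rho_A=\rho^pA^p+\rho^sA^s,\quad \rho_I=\rho^pI^p+\rho^sI^s,\quad \rho_{I_0}=\rho^pI_0^p,\quad C_A=C^pA^p+C^sA^s,\quad C_I=C^pI^p+C^sI^s,\quad C_{I_0}=C^pI_0^p .$$ Let $L^2(0,1)$ and $H^k(0,1)$ be the real Lebesgue and Sobolev spaces, and let $H^1_0(0,1):=\{f\in H^1(0,1): f(0)=0\}$ (no condition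 at $1$). The energy space is $\mathcal X_{EB}=H^1_0(0,1)^3\times L^2(0,1)^3$, with states $x=(x_1,\dots,x_6)=(v,w_z,\Phi,\dot v,\dot w_z,\dot\Phi)$ and inner product $$\langle x,y\rangle=\int_0^1\Big[C_Ax_1'y_1'+C_Ix_2'y_2'-C_{I_0}(x_1'y_2'+x_2'y_1')+\tfrac1\mu A^px_3'y_3'+\rho_Ax_4y_4+\rho_Ix_5y_5-\rho_{I_0}(x_4y_5+x_5y_4)+\epsilon_{33}A^px_6y_6\Big]dz,$$ so that $\|x\|^2=\langle x,x\rangle=2\mathcal H_{EB}$ is twice the total energy. With $\Delta=\rho_A\rho_I-\rho_{I_0}^2$ (which is positive), let $$a_{41}=\tfrac{\rho_IC_A-\rho_{I_0}C_{I_0}}{\Delta},\; a_{42}=\tfrac{\rho_IC_{I_0}-\rho_{I_0}C_I}{\Delta},\; a_{46}=\gamma\tfrac{\rho_IA^p-\rho_{I_0}I_0^p}{\Delta},\; a_{51}=\tfrac{\rho_AC_{I_0}-\rho_{I_0}C_A}{\Delta},\; a_{52}=\tfrac{\rho_AC_I-\rho_{I_0}C_{I_0}}{\Delta},\; a_{56}=\gamma\tfrac{\rho_AI_0^p-\rho_{I_0}A^p}{\Delta},$$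 $$a_{63}=\tfrac1{\epsilon_{33}\mu},\quad a_{64}=\tfrac{\gamma}{\epsilon_{33}},\quad a_{65}=\tfrac{\gamma I_0^p}{\epsilon_{33}A^p}.$$ The operator of the current-controlled piezoelectric composite with Euler–Bernoulli beam theory and zero input is $$\mathcal A_{EB}x=\big(x_4,\;x_5,\;x_6,\;a_{41}x_1''-a_{42}x_2''-a_{46}x_6',\;-a_{51}x_1''+a_{52}x_2''+a_{56}x_6',\;a_{63}x_3''-a_{64}x_4'+a_{65}x_5'\big),$$ with domain $\operatorname{Dom}(\mathcal A_{EB})$ consisting of all $x\in\mathcal X_{EB}$ with $x_1,x_2,x_3\in H^2(0,1)$, $x_4,x_5,x_6\in H^1_0(0,1)$ and $$C_Ax_1'(1)-C_{I_0}x_2'(1)-\gamma A^px_6(1)=0,\qquad C_Ix_2'(1)-C_{I_0}x_1'(1)+\gamma I_0^px_6(1)=0,\qquad \tfrac1\mu A^px_3'(1)=0 .$$ **Theorem.** The space $\mathcal X_{EB}$ with this inner product is a Hilbert space, and $\mathcal A_{EB}$ is the infinitesimal generator of a strongly continuous semigroup of contractions $(T(t))_{t\ge0}$ on $\mathcal X_{EB}$,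 that is, $\|T(t)\|\le1$ for all $t\ge0$. -/

import Mathlib

open MeasureTheory Set Filter Topology
open scoped NNReal

noncomputable section

/-! ### Function spaces on the interval `(0,1)` -/

/-- The real Hilbert space `L²(0,1)`. -/
abbrev L2I : Type := Lp ℝ 2 (volume.restrict (Ioo (0 : ℝ) 1))

/-- `g` is a weak derivative of `u` on `(0,1)`: `∫ u φ' = - ∫ g φ` for all `φ ∈ C_c^∞(0,1)`. -/
def HasWeakDeriv (u g : L2I) : Prop :=
  ∀ φ : ℝ → ℝ, ContDiff ℝ ((⊤ : ℕ∞) : WithTop ℕ∞) φ → HasCompactSupport φ →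
    tsupport φ ⊆ Ioo (0 : ℝ) 1 →
    ∫ z in Ioo (0 : ℝ) 1, u z * deriv φ z = - ∫ z in Ioo (0 : ℝ) 1, g z * φ z

/-- The value at `a ∈ [0,1]` of (the continuous representative on `[0,1]` of) `u` is `c`. -/
def HasValueAt (u : L2I) (a c : ℝ) : Prop :=
  ∃ f : ℝ → ℝ, ContinuousOn f (Icc 0 1) ∧
    (u : ℝ → ℝ) =ᵐ[volume.restrict (Ioo (0 : ℝ) 1)] f ∧ f a = c

theorem L2I.integrable_mul_bdd (u : L2I) {φ : ℝ → ℝ} (hφ : Continuous φ)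
    (hc : HasCompactSupport φ) :
    Integrable (fun z => u z * φ z) (volume.restrict (Ioo (0 : ℝ) 1)) := by
  have h1 : Integrable (u : ℝ → ℝ) (volume.restrict (Ioo (0 : ℝ) 1)) :=
    (Lp.memLp u).integrable (by norm_num)
  obtain ⟨C, hC⟩ := hc.exists_bound_of_continuous hφ
  exact h1.mul_bdd (c := C) hφ.aestronglyMeasurable (Eventually.of_forall hC)

theorem HasWeakDeriv.add {u v g h : L2I} (hu : HasWeakDeriv u g) (hv : HasWeakDeriv v h) :
    HasWeakDeriv (u + v) (g + h) := by
  intro φ h1 h2 h3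
  have hd : Continuous (deriv φ) := h1.continuous_deriv (by norm_cast)
  have e1 : ∫ z in Ioo (0 : ℝ) 1, (u + v : L2I) z * deriv φ z
      = ∫ z in Ioo (0 : ℝ) 1, (u z * deriv φ z + v z * deriv φ z) := by
    refine integral_congr_ae ?_
    filter_upwards [Lp.coeFn_add u v] with z hz
    rw [hz, Pi.add_apply, add_mul]
  have e2 : ∫ z in Ioo (0 : ℝ) 1, (g + h : L2I) z * φ z
      = ∫ z in Ioo (0 : ℝ) 1, (g z * φ z + h z * φ z) := by
    refine integral_congr_ae ?_
    filter_upwards [Lp.coeFn_add g h] with z hz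
    rw [hz, Pi.add_apply, add_mul]
  rw [e1, e2, integral_add (u.integrable_mul_bdd hd h2.deriv) (v.integrable_mul_bdd hd h2.deriv),
    integral_add (g.integrable_mul_bdd h1.continuous h2) (h.integrable_mul_bdd h1.continuous h2),
    hu φ h1 h2 h3, hv φ h1 h2 h3]
  ring

theorem HasWeakDeriv.smul {u g : L2I} (c : ℝ) (hu : HasWeakDeriv u g) :
    HasWeakDeriv (c • u) (c • g) := by
  intro φ h1 h2 h3
  have e1 : ∫ z in Ioo (0 : ℝ) 1, (c • u : L2I) z * deriv φ z
      = ∫ z in Ioo (0 : ℝ) 1, c * (u z * deriv φ z) := by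
    refine integral_congr_ae ?_
    filter_upwards [Lp.coeFn_smul c u] with z hz
    rw [hz, Pi.smul_apply, smul_eq_mul, mul_assoc]
  have e2 : ∫ z in Ioo (0 : ℝ) 1, (c • g : L2I) z * φ z
      = ∫ z in Ioo (0 : ℝ) 1, c * (g z * φ z) := by
    refine integral_congr_ae ?_
    filter_upwards [Lp.coeFn_smul c g] with z hz
    rw [hz, Pi.smul_apply, smul_eq_mul, mul_assoc]
  rw [e1, e2, integral_const_mul, integral_const_mul, hu φ h1 h2 h3]
  ring

theorem HasWeakDeriv.zero : HasWeakDeriv 0 0 := by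
  have h : ∀ ψ : ℝ → ℝ, ∫ z in Ioo (0 : ℝ) 1, (0 : L2I) z * ψ z = 0 := by
    intro ψ
    refine integral_eq_zero_of_ae ?_
    filter_upwards [Lp.coeFn_zero ℝ 2 (volume.restrict (Ioo (0 : ℝ) 1))] with z hz
    rw [hz, Pi.zero_apply]
    exact zero_mul _
  intro φ _ _ _
  rw [h, h, neg_zero]

theorem L2I.eq_of_test {g h : L2I}
    (H : ∀ φ : ℝ → ℝ, ContDiff ℝ ((⊤ : ℕ∞) : WithTop ℕ∞) φ → HasCompactSupport φ →
      tsupport φ ⊆ Ioo (0 : ℝ) 1 →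
      ∫ z in Ioo (0 : ℝ) 1, g z * φ z = ∫ z in Ioo (0 : ℝ) 1, h z * φ z) : g = h := by
  rw [← sub_eq_zero, Lp.eq_zero_iff_ae_eq_zero]
  have hi : IntegrableOn ((g - h : L2I) : ℝ → ℝ) (Ioo (0 : ℝ) 1) :=
    (Lp.memLp (g - h)).integrable (by norm_num)
  refine (ae_restrict_iff' measurableSet_Ioo).2
    (isOpen_Ioo.ae_eq_zero_of_integral_contDiff_smul_eq_zero hi.locallyIntegrableOn ?_)
  intro φ h1 h2 h3
  have hs : ∀ z, z ∉ Ioo (0 : ℝ) 1 → φ z • (g - h : L2I) z = 0 := fun z hz => by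
    rw [image_eq_zero_of_notMem_tsupport (fun hz' => hz (h3 hz')), zero_smul]
  rw [← setIntegral_eq_integral_of_forall_compl_eq_zero hs]
  have e1 : ∫ z in Ioo (0 : ℝ) 1, φ z • (g - h : L2I) z
      = ∫ z in Ioo (0 : ℝ) 1, (g z * φ z - h z * φ z) := by
    refine integral_congr_ae ?_
    filter_upwards [Lp.coeFn_sub g h] with z hz
    rw [hz, Pi.sub_apply, smul_eq_mul]
    ring
  rw [e1, integral_sub (g.integrable_mul_bdd h1.continuous h2)
    (h.integrable_mul_bdd h1.continuous h2), H φ h1 h2 h3, sub_self]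

theorem HasWeakDeriv.unique {u g h : L2I} (hg : HasWeakDeriv u g) (hh : HasWeakDeriv u h) :
    g = h :=
  L2I.eq_of_test fun φ h1 h2 h3 => by
    have := (hg φ h1 h2 h3).symm.trans (hh φ h1 h2 h3)
    linarith

/-- The Sobolev space `H¹(0,1)`. -/
def H1 : Submodule ℝ L2I where
  carrier := {u | ∃ g, HasWeakDeriv u g}
  add_mem' := fun ⟨g, hg⟩ ⟨h, hh⟩ => ⟨g + h, hg.add hh⟩
  zero_mem' := ⟨0, HasWeakDeriv.zero⟩
  smul_mem' := fun c _ ⟨g, hg⟩ => ⟨c • g, hg.smul c⟩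

open Classical in
/-- The weak derivative of `u ∈ H¹(0,1)` (and `0` if `u ∉ H¹(0,1)`). -/
def weakDeriv (u : L2I) : L2I := if h : ∃ g, HasWeakDeriv u g then h.choose else 0

theorem hasWeakDeriv_weakDeriv {u : L2I} (hu : u ∈ H1) : HasWeakDeriv u (weakDeriv u) := by
  have h : ∃ g, HasWeakDeriv u g := hu
  rw [weakDeriv, dif_pos h]
  exact h.choose_spec

theorem HasWeakDeriv.weakDeriv_eq {u g : L2I} (h : HasWeakDeriv u g) : weakDeriv u = g :=
  (hasWeakDeriv_weakDeriv ⟨g, h⟩).unique h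

theorem weakDeriv_add {u v : L2I} (hu : u ∈ H1) (hv : v ∈ H1) :
    weakDeriv (u + v) = weakDeriv u + weakDeriv v :=
  ((hasWeakDeriv_weakDeriv hu).add (hasWeakDeriv_weakDeriv hv)).weakDeriv_eq

theorem weakDeriv_smul (c : ℝ) {u : L2I} (hu : u ∈ H1) :
    weakDeriv (c • u) = c • weakDeriv u :=
  ((hasWeakDeriv_weakDeriv hu).smul c).weakDeriv_eq

theorem HasValueAt.add {u v : L2I} {a c d : ℝ} (hu : HasValueAt u a c) (hv : HasValueAt v a d) :
    HasValueAt (u + v) a (c + d) := by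
  obtain ⟨f, f1, f2, f3⟩ := hu
  obtain ⟨g, g1, g2, g3⟩ := hv
  refine ⟨f + g, f1.add g1, ?_, by simp [f3, g3]⟩
  exact (Lp.coeFn_add u v).trans (f2.add g2)

theorem HasValueAt.smul {u : L2I} {a c : ℝ} (r : ℝ) (hu : HasValueAt u a c) :
    HasValueAt (r • u) a (r * c) := by
  obtain ⟨f, f1, f2, f3⟩ := hu
  refine ⟨r • f, f1.const_smul r, ?_, by simp [f3]⟩
  exact (Lp.coeFn_smul r u).trans (f2.const_smul r)

theorem HasValueAt.zero (a : ℝ) : HasValueAt 0 a 0 :=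
  ⟨0, continuousOn_const, Lp.coeFn_zero _ _ _, rfl⟩

/-- `H¹₀(0,1) = {f ∈ H¹(0,1) | f(0) = 0}` (no condition at the right end point). -/
def H10 : Submodule ℝ L2I where
  carrier := {u | u ∈ H1 ∧ HasValueAt u 0 0}
  add_mem' := fun ⟨h1, h2⟩ ⟨k1, k2⟩ => ⟨H1.add_mem h1 k1, by simpa using h2.add k2⟩
  zero_mem' := ⟨H1.zero_mem, HasValueAt.zero 0⟩
  smul_mem' := fun c _ ⟨h1, h2⟩ => ⟨H1.smul_mem c h1, by simpa using h2.smul c⟩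

theorem H10_le_H1 : H10 ≤ H1 := fun _ h => h.1

/-- A function on `(0,1)` with vanishing weak derivative is constant. -/
theorem HasWeakDeriv.eq_const {u : L2I} (hu : HasWeakDeriv u 0) :
    ∃ c : ℝ, (u : ℝ → ℝ) =ᵐ[volume.restrict (Ioo (0 : ℝ) 1)] fun _ => c := by
  -- a normalised test function
  let B : ContDiffBump (1 / 2 : ℝ) := ⟨1 / 8, 1 / 4, by norm_num, by norm_num⟩
  let η : ℝ → ℝ := B.normed volume
  have hη1 : ContDiff ℝ ((⊤ : ℕ∞) : WithTop ℕ∞) η := B.contDiff_normed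
  have hη2 : HasCompactSupport η := B.hasCompactSupport_normed
  have hη3 : tsupport η ⊆ Ioo (0 : ℝ) 1 := by
    rw [B.tsupport_normed_eq, Real.closedBall_eq_Icc]
    exact Icc_subset_Ioo (by norm_num) (by norm_num)
  have hη4 : ∫ z, η z = 1 := B.integral_normed
  let c : ℝ := ∫ z in Ioo (0 : ℝ) 1, u z * η z
  refine ⟨c, ?_⟩
  have hc : MemLp (fun _ : ℝ => c) 2 (volume.restrict (Ioo (0 : ℝ) 1)) := memLp_const c
  suffices H : u = hc.toLp _ by
    rw [H]
    exact hc.coeFn_toLp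
  refine L2I.eq_of_test fun ψ h1 h2 h3 => ?_
  have full : ∀ θ : ℝ → ℝ, tsupport θ ⊆ Ioo (0 : ℝ) 1 →
      ∫ z in Ioo (0 : ℝ) 1, θ z = ∫ z, θ z := fun θ hθ =>
    setIntegral_eq_integral_of_forall_compl_eq_zero fun z hz =>
      image_eq_zero_of_notMem_tsupport fun hz' => hz (hθ hz')
  have e1 : ∫ z in Ioo (0 : ℝ) 1, hc.toLp _ z * ψ z = c * ∫ z, ψ z := by
    rw [← full ψ h3, ← integral_const_mul]
    refine integral_congr_ae ?_
    filter_upwards [hc.coeFn_toLp] with z hz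
    rw [hz]
  rw [e1]
  set m : ℝ := ∫ z, ψ z with hm
  let χ : ℝ → ℝ := fun z => ψ z - m * η z
  have hχ1 : ContDiff ℝ ((⊤ : ℕ∞) : WithTop ℕ∞) χ := h1.sub (contDiff_const.mul hη1)
  have hχi : Integrable χ := (h1.continuous.integrable_of_hasCompactSupport h2).sub
    ((hη1.continuous.integrable_of_hasCompactSupport hη2).const_mul m)
  have hχ0 : ∫ z, χ z = 0 := by
    rw [integral_sub (h1.continuous.integrable_of_hasCompactSupport h2)
      ((hη1.continuous.integrable_of_hasCompactSupport hη2).const_mul m), integral_const_mul,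
      hη4, ← hm]
    ring
  -- a compact interval containing the supports
  obtain ⟨a, b, ha, hb, hab⟩ : ∃ a b : ℝ, 0 < a ∧ b < 1 ∧ ∀ z, z ∉ Icc a b → χ z = 0 := by
    have hK : IsCompact (tsupport ψ ∪ tsupport η) := h2.isCompact.union hη2.isCompact
    have hne : (tsupport ψ ∪ tsupport η).Nonempty := by
      by_contra hne
      rw [not_nonempty_iff_eq_empty] at hne
      have hz : ∀ z, η z = 0 := fun z => image_eq_zero_of_notMem_tsupport fun hz => by
        have : z ∈ tsupport ψ ∪ tsupport η := Or.inr hz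
        rw [hne] at this
        exact this
      simp [hz] at hη4
    have hsub : tsupport ψ ∪ tsupport η ⊆ Ioo (0 : ℝ) 1 := union_subset h3 hη3
    refine ⟨sInf (tsupport ψ ∪ tsupport η), sSup (tsupport ψ ∪ tsupport η),
      (hsub (hK.sInf_mem hne)).1, (hsub (hK.sSup_mem hne)).2, fun z hz => ?_⟩
    have hz' : z ∉ tsupport ψ ∪ tsupport η := fun h =>
      hz ⟨csInf_le hK.bddBelow h, le_csSup hK.bddAbove h⟩
    have k1 : ψ z = 0 := image_eq_zero_of_notMem_tsupport fun h => hz' (Or.inl h)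
    have k2 : η z = 0 := image_eq_zero_of_notMem_tsupport fun h => hz' (Or.inr h)
    simp [χ, k1, k2]
  let φ : ℝ → ℝ := fun x => ∫ z in (0 : ℝ)..x, χ z
  have hφd : ∀ x, HasDerivAt φ (χ x) x := fun x =>
    intervalIntegral.integral_hasDerivAt_right (hχi.intervalIntegrable)
      (hχ1.continuous.stronglyMeasurableAtFilter _ _) hχ1.continuous.continuousAt
  have hφ' : deriv φ = χ := funext fun x => (hφd x).deriv
  have hφ1 : ContDiff ℝ ((⊤ : ℕ∞) : WithTop ℕ∞) φ :=
    contDiff_infty_iff_deriv.2 ⟨fun x => (hφd x).differentiableAt, by rw [hφ']; exact hχ1⟩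
  have hφ0 : ∀ z, z ∉ Icc a b → φ z = 0 := by
    intro x hx
    rcases lt_or_ge x a with hxa | hxa
    · refine (intervalIntegral.integral_congr (g := fun _ => (0 : ℝ)) fun z hz => ?_).trans
        (by simp)
      refine hab z fun hz' => ?_
      have : z ≤ max 0 x := hz.2
      have := max_lt ha hxa
      linarith [hz'.1]
    · have hxb : b < x := not_le.1 fun h => hx ⟨hxa, h⟩
      have hx0 : 0 ≤ x := ha.le.trans hxa
      change ∫ z in (0 : ℝ)..x, χ z = 0
      rw [intervalIntegral.integral_of_le hx0]
      refine Eq.trans ?_ hχ0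
      refine setIntegral_eq_integral_of_forall_compl_eq_zero fun z hz => hab z fun hz' => ?_
      exact hz ⟨ha.trans_le hz'.1, hz'.2.trans hxb.le⟩
  have hφs : tsupport φ ⊆ Icc a b := closure_minimal
    (fun z hz => by_contra fun h => hz (hφ0 z h)) isClosed_Icc
  have hφ2 : HasCompactSupport φ :=
    isCompact_Icc.of_isClosed_subset (isClosed_tsupport φ) hφs
  have key := hu φ hφ1 hφ2 (hφs.trans (Icc_subset_Ioo ha hb))
  have hzero : ∫ z in Ioo (0 : ℝ) 1, (0 : L2I) z * φ z = 0 := by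
    refine integral_eq_zero_of_ae ?_
    filter_upwards [Lp.coeFn_zero ℝ 2 (volume.restrict (Ioo (0 : ℝ) 1))] with z hz
    rw [hz, Pi.zero_apply]
    exact zero_mul _
  rw [hzero, neg_zero, hφ'] at key
  have e2 : ∫ z in Ioo (0 : ℝ) 1, u z * χ z
      = (∫ z in Ioo (0 : ℝ) 1, u z * ψ z) - m * c := by
    rw [← integral_const_mul, ← integral_sub (u.integrable_mul_bdd h1.continuous h2)
      ((u.integrable_mul_bdd hη1.continuous hη2).const_mul m)]
    refine integral_congr_ae (Eventually.of_forall fun z => ?_)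
    simp only [χ]
    ring
  rw [e2] at key
  linarith

theorem eq_zero_of_weakDeriv_eq_zero {u : L2I} (hu : u ∈ H10) (h : weakDeriv u = 0) : u = 0 := by
  have h0 := hasWeakDeriv_weakDeriv hu.1
  rw [h] at h0
  obtain ⟨c, hc⟩ := h0.eq_const
  obtain ⟨f, f1, f2, f3⟩ := hu.2
  have h1 : (fun _ : ℝ => c) =ᵐ[volume.restrict (Icc (0 : ℝ) 1)] f := by
    rw [← restrict_Ioo_eq_restrict_Icc]
    exact hc.symm.trans f2
  have h2 := Measure.eqOn_Icc_of_ae_eq volume zero_ne_one h1 continuousOn_const f1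
    (left_mem_Icc.2 zero_le_one)
  rw [f3] at h2
  rw [Lp.eq_zero_iff_ae_eq_zero]
  filter_upwards [hc] with z hz
  rw [hz]
  exact h2

/-! ### Strongly continuous semigroups -/

/-- `T` is a strongly continuous (`C₀`) semigroup of bounded operators on `X`. -/
structure IsC0Semigroup {X : Type*} [NormedAddCommGroup X] [NormedSpace ℝ X]
    (T : ℝ≥0 → X →L[ℝ] X) : Prop where
  zero : T 0 = ContinuousLinearMap.id ℝ X
  add : ∀ s t, T (s + t) = (T s).comp (T t)
  tendsto : ∀ x, Tendsto (fun t => T t x) (𝓝[>] 0) (𝓝 x)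

/-- The (possibly unbounded) operator `A` is the infinitesimal generator of `T`: a vector `x` lies
in the domain of `A` exactly when `lim_{t ↓ 0} (T(t) x - x) / t` exists, and `A x` is this limit. -/
def IsGenerator {X : Type*} [NormedAddCommGroup X] [NormedSpace ℝ X]
    (A : X →ₗ.[ℝ] X) (T : ℝ≥0 → X →L[ℝ] X) : Prop :=
  ∀ x y : X, (x, y) ∈ A.graph ↔
    Tendsto (fun t : ℝ≥0 => (t : ℝ)⁻¹ • (T t x - x)) (𝓝[>] 0) (𝓝 y)

/-! ### The piezoelectric composite -/

/-- Physical data of a composite beam of unit length and width `2 g`: a mechanical substrate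
occupying the thickness range `[-h₁, h₁]`, with a piezoelectric layer occupying `[h₁, h₂]` bonded
on top of it. -/
structure PiezoComposite where
  /-- half of the width -/
  g : ℝ
  /-- half of the thickness of the substrate -/
  h₁ : ℝ
  /-- height of the upper surface of the piezoelectric layer -/
  h₂ : ℝ
  /-- mass density of the piezoelectric layer -/
  ρp : ℝ
  /-- mass density of the substrate -/
  ρs : ℝ
  /-- stiffness of the piezoelectric layer -/
  Cp : ℝ
  /-- stiffness of the substrate -/
  Cs : ℝ
  /-- permittivity -/
  ε : ℝ
  /-- magnetic permeability -/
  μ : ℝ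
  /-- piezoelectric coupling coefficient (of arbitrary sign) -/
  γ : ℝ
  g_pos : 0 < g
  h₁_pos : 0 < h₁
  h₁_lt_h₂ : h₁ < h₂
  ρp_pos : 0 < ρp
  ρs_pos : 0 < ρs
  Cp_pos : 0 < Cp
  Cs_pos : 0 < Cs
  ε_pos : 0 < ε
  μ_pos : 0 < μ

namespace PiezoComposite

/-- Area `∫∫ 1 dz₂ dz₃` of the cross-section `[-g, g] × [a, b]`. -/
def area (g a b : ℝ) : ℝ := 2 * g * (b - a)

/-- Second moment `∫∫ z₃² dz₂ dz₃` of the cross-section `[-g, g] × [a, b]`. -/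
def inertia (g a b : ℝ) : ℝ := 2 / 3 * g * (b ^ 3 - a ^ 3)

/-- First moment `∫∫ z₃ dz₂ dz₃` of the cross-section `[-g, g] × [a, b]`. -/
def moment (g a b : ℝ) : ℝ := g * (b ^ 2 - a ^ 2)

variable (P : PiezoComposite)

/-- `A^p` -/
def Ap : ℝ := area P.g P.h₁ P.h₂
/-- `I^p` -/
def Ip : ℝ := inertia P.g P.h₁ P.h₂
/-- `I_0^p` -/
def I0p : ℝ := moment P.g P.h₁ P.h₂
/-- `A^s` -/
def As : ℝ := area P.g (-P.h₁) P.h₁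
/-- `I^s` -/
def Is : ℝ := inertia P.g (-P.h₁) P.h₁

/-- `ρ_A` -/
def ρA : ℝ := P.ρp * P.Ap + P.ρs * P.As
/-- `ρ_I` -/
def ρI : ℝ := P.ρp * P.Ip + P.ρs * P.Is
/-- `ρ_{I_0}` -/
def ρI0 : ℝ := P.ρp * P.I0p
/-- `C_A` -/
def CA : ℝ := P.Cp * P.Ap + P.Cs * P.As
/-- `C_I` -/
def CI : ℝ := P.Cp * P.Ip + P.Cs * P.Is
/-- `C_{I_0}` -/
def CI0 : ℝ := P.Cp * P.I0p

/-- The determinant `ρ_A ρ_I - ρ_{I_0}²` of the mass matrix. -/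
def Δ : ℝ := P.ρA * P.ρI - P.ρI0 ^ 2

def a41 : ℝ := (P.ρI * P.CA - P.ρI0 * P.CI0) / P.Δ
def a42 : ℝ := (P.ρI * P.CI0 - P.ρI0 * P.CI) / P.Δ
def a46 : ℝ := P.γ * ((P.ρI * P.Ap - P.ρI0 * P.I0p) / P.Δ)
def a51 : ℝ := (P.ρA * P.CI0 - P.ρI0 * P.CA) / P.Δ
def a52 : ℝ := (P.ρA * P.CI - P.ρI0 * P.CI0) / P.Δ
def a56 : ℝ := P.γ * ((P.ρA * P.I0p - P.ρI0 * P.Ap) / P.Δ)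
def a63 : ℝ := 1 / (P.ε * P.μ)
def a64 : ℝ := P.γ * (1 / P.ε)
def a65 : ℝ := P.γ * (P.I0p / (P.ε * P.Ap))

theorem Ap_pos : 0 < P.Ap := by
  have := P.g_pos
  have := sub_pos.2 P.h₁_lt_h₂
  unfold Ap area
  positivity

/-- Positivity of the weighted section matrix, for any positive weights `r`, `s`. -/
theorem weighted_pos {r s : ℝ} (hr : 0 < r) (hs : 0 < s) :
    0 < r * P.Ap + s * P.As ∧
      0 < (r * P.Ap + s * P.As) * (r * P.Ip + s * P.Is) - (r * P.I0p) ^ 2 := by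
  have hg := P.g_pos
  have h1 := P.h₁_pos
  have hd := sub_pos.2 P.h₁_lt_h₂
  have hAp := P.Ap_pos
  have hAs : 0 < P.As := by unfold As area; nlinarith [mul_pos hg h1]
  have hIs : 0 < P.Is := by
    have : P.Is = 4 / 3 * P.g * P.h₁ ^ 3 := by unfold Is inertia; ring
    rw [this]; positivity
  have hIp : 0 < P.Ip := by
    have : P.Ip = 2 / 3 * P.g * ((P.h₂ - P.h₁) * ((P.h₂ - P.h₁) ^ 2
        + 3 * (P.h₂ - P.h₁) * P.h₁ + 3 * P.h₁ ^ 2)) := by unfold Ip inertia; ring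
    rw [this]; positivity
  have hdet : P.Ap * P.Ip - P.I0p ^ 2 = P.g ^ 2 * (P.h₂ - P.h₁) ^ 4 / 3 := by
    unfold Ap Ip I0p area inertia moment; ring
  have hdet' : 0 < P.Ap * P.Ip - P.I0p ^ 2 := by rw [hdet]; positivity
  refine ⟨by positivity, ?_⟩
  have e : (r * P.Ap + s * P.As) * (r * P.Ip + s * P.Is) - (r * P.I0p) ^ 2
      = r ^ 2 * (P.Ap * P.Ip - P.I0p ^ 2) + r * s * (P.Ap * P.Is) + r * s * (P.As * P.Ip)
        + s ^ 2 * (P.As * P.Is) := by ring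
  rw [e]; positivity

/-! ### The energy space -/

/-- The underlying linear space `H¹₀(0,1)³ × L²(0,1)³` of the energy space; it carries the energy
inner product below, not the product norm. -/
def EnergySpace (_P : PiezoComposite) : Type := H10 × H10 × H10 × L2I × L2I × L2I

namespace EnergySpace

instance : AddCommGroup (EnergySpace P) :=
  inferInstanceAs (AddCommGroup (H10 × H10 × H10 × L2I × L2I × L2I))

instance : Module ℝ (EnergySpace P) :=
  inferInstanceAs (Module ℝ (H10 × H10 × H10 × L2I × L2I × L2I))

variable {P}

/-- The components of a state `x = (v, w_z, Φ, v̇, ẇ_z, Φ̇)`. -/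
def x₁ (x : EnergySpace P) : L2I := x.1
/-- second component -/
def x₂ (x : EnergySpace P) : L2I := x.2.1
/-- third component -/
def x₃ (x : EnergySpace P) : L2I := x.2.2.1
/-- fourth component -/
def x₄ (x : EnergySpace P) : L2I := x.2.2.2.1
/-- fifth component -/
def x₅ (x : EnergySpace P) : L2I := x.2.2.2.2.1
/-- sixth component -/
def x₆ (x : EnergySpace P) : L2I := x.2.2.2.2.2

theorem x₁_mem (x : EnergySpace P) : x.x₁ ∈ H10 := x.1.2
theorem x₂_mem (x : EnergySpace P) : x.x₂ ∈ H10 := x.2.1.2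
theorem x₃_mem (x : EnergySpace P) : x.x₃ ∈ H10 := x.2.2.1.2

/-- The state with the given components. -/
def mk (u₁ u₂ u₃ : H10) (u₄ u₅ u₆ : L2I) : EnergySpace P := (u₁, u₂, u₃, u₄, u₅, u₆)

@[simp] theorem mk_x₁ (u₁ u₂ u₃ : H10) (u₄ u₅ u₆ : L2I) :
    (mk u₁ u₂ u₃ u₄ u₅ u₆ : EnergySpace P).x₁ = u₁ := rfl
@[simp] theorem mk_x₂ (u₁ u₂ u₃ : H10) (u₄ u₅ u₆ : L2I) :
    (mk u₁ u₂ u₃ u₄ u₅ u₆ : EnergySpace P).x₂ = u₂ := rfl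
@[simp] theorem mk_x₃ (u₁ u₂ u₃ : H10) (u₄ u₅ u₆ : L2I) :
    (mk u₁ u₂ u₃ u₄ u₅ u₆ : EnergySpace P).x₃ = u₃ := rfl
@[simp] theorem mk_x₄ (u₁ u₂ u₃ : H10) (u₄ u₅ u₆ : L2I) :
    (mk u₁ u₂ u₃ u₄ u₅ u₆ : EnergySpace P).x₄ = u₄ := rfl
@[simp] theorem mk_x₅ (u₁ u₂ u₃ : H10) (u₄ u₅ u₆ : L2I) :
    (mk u₁ u₂ u₃ u₄ u₅ u₆ : EnergySpace P).x₅ = u₅ := rfl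
@[simp] theorem mk_x₆ (u₁ u₂ u₃ : H10) (u₄ u₅ u₆ : L2I) :
    (mk u₁ u₂ u₃ u₄ u₅ u₆ : EnergySpace P).x₆ = u₆ := rfl

theorem ext' {x y : EnergySpace P} (h₁ : x.x₁ = y.x₁) (h₂ : x.x₂ = y.x₂) (h₃ : x.x₃ = y.x₃)
    (h₄ : x.x₄ = y.x₄) (h₅ : x.x₅ = y.x₅) (h₆ : x.x₆ = y.x₆) : x = y :=
  Prod.ext (Subtype.ext h₁) (Prod.ext (Subtype.ext h₂) (Prod.ext (Subtype.ext h₃)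
    (Prod.ext h₄ (Prod.ext h₅ h₆))))

@[simp] theorem add_x₁ (x y : EnergySpace P) : (x + y).x₁ = x.x₁ + y.x₁ := rfl
@[simp] theorem add_x₂ (x y : EnergySpace P) : (x + y).x₂ = x.x₂ + y.x₂ := rfl
@[simp] theorem add_x₃ (x y : EnergySpace P) : (x + y).x₃ = x.x₃ + y.x₃ := rfl
@[simp] theorem add_x₄ (x y : EnergySpace P) : (x + y).x₄ = x.x₄ + y.x₄ := rfl
@[simp] theorem add_x₅ (x y : EnergySpace P) : (x + y).x₅ = x.x₅ + y.x₅ := rfl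
@[simp] theorem add_x₆ (x y : EnergySpace P) : (x + y).x₆ = x.x₆ + y.x₆ := rfl
@[simp] theorem smul_x₁ (c : ℝ) (x : EnergySpace P) : (c • x).x₁ = c • x.x₁ := rfl
@[simp] theorem smul_x₂ (c : ℝ) (x : EnergySpace P) : (c • x).x₂ = c • x.x₂ := rfl
@[simp] theorem smul_x₃ (c : ℝ) (x : EnergySpace P) : (c • x).x₃ = c • x.x₃ := rfl
@[simp] theorem smul_x₄ (c : ℝ) (x : EnergySpace P) : (c • x).x₄ = c • x.x₄ := rfl
@[simp] theorem smul_x₅ (c : ℝ) (x : EnergySpace P) : (c • x).x₅ = c • x.x₅ := rfl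
@[simp] theorem smul_x₆ (c : ℝ) (x : EnergySpace P) : (c • x).x₆ = c • x.x₆ := rfl
@[simp] theorem zero_x₁ : (0 : EnergySpace P).x₁ = 0 := rfl
@[simp] theorem zero_x₂ : (0 : EnergySpace P).x₂ = 0 := rfl
@[simp] theorem zero_x₃ : (0 : EnergySpace P).x₃ = 0 := rfl
@[simp] theorem zero_x₄ : (0 : EnergySpace P).x₄ = 0 := rfl
@[simp] theorem zero_x₅ : (0 : EnergySpace P).x₅ = 0 := rfl
@[simp] theorem zero_x₆ : (0 : EnergySpace P).x₆ = 0 := rfl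

/-- The energy inner product; `⟨x, x⟩` is twice the total energy (Hamiltonian) of the state `x`. -/
def energyInner (x y : EnergySpace P) : ℝ :=
  ∫ z in Ioo (0 : ℝ) 1,
    (P.CA * (weakDeriv x.x₁ z * weakDeriv y.x₁ z) + P.CI * (weakDeriv x.x₂ z * weakDeriv y.x₂ z)
      - P.CI0 * (weakDeriv x.x₁ z * weakDeriv y.x₂ z + weakDeriv x.x₂ z * weakDeriv y.x₁ z)
      + 1 / P.μ * P.Ap * (weakDeriv x.x₃ z * weakDeriv y.x₃ z)
      + P.ρA * (x.x₄ z * y.x₄ z) + P.ρI * (x.x₅ z * y.x₅ z)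
      - P.ρI0 * (x.x₄ z * y.x₅ z + x.x₅ z * y.x₄ z)
      + P.ε * P.Ap * (x.x₆ z * y.x₆ z))

theorem energyInner_eq (x y : EnergySpace P) : energyInner x y =
    P.CA * inner ℝ (weakDeriv x.x₁) (weakDeriv y.x₁)
      + P.CI * inner ℝ (weakDeriv x.x₂) (weakDeriv y.x₂)
      - P.CI0 * (inner ℝ (weakDeriv x.x₁) (weakDeriv y.x₂)
          + inner ℝ (weakDeriv x.x₂) (weakDeriv y.x₁))
      + 1 / P.μ * P.Ap * inner ℝ (weakDeriv x.x₃) (weakDeriv y.x₃)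
      + P.ρA * inner ℝ x.x₄ y.x₄ + P.ρI * inner ℝ x.x₅ y.x₅
      - P.ρI0 * (inner ℝ x.x₄ y.x₅ + inner ℝ x.x₅ y.x₄)
      + P.ε * P.Ap * inner ℝ x.x₆ y.x₆ := by
  have hi : ∀ u v : L2I, Integrable (fun z => u z * v z) (volume.restrict (Ioo (0 : ℝ) 1)) :=
    fun u v => (Lp.memLp u).integrable_mul (Lp.memLp v)
  have he : ∀ u v : L2I, inner ℝ u v = ∫ z in Ioo (0 : ℝ) 1, u z * v z := fun u v => by
    rw [L2.inner_def]
    refine integral_congr_ae (Eventually.of_forall fun z => ?_)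
    simp [mul_comm]
  simp only [he, energyInner]
  rw [integral_add, integral_sub, integral_add, integral_add, integral_add, integral_sub,
    integral_add]
  · simp only [integral_const_mul]
    rw [integral_add (hi _ _) (hi _ _), integral_add (hi _ _) (hi _ _)]
  all_goals
    repeat' first
      | apply Integrable.add
      | apply Integrable.sub
      | apply Integrable.neg
      | apply Integrable.const_mul
      | exact hi _ _

theorem weakDeriv_add_of_mem {u v : L2I} (hu : u ∈ H10) (hv : v ∈ H10) :
    weakDeriv (u + v) = weakDeriv u + weakDeriv v := weakDeriv_add hu.1 hv.1

theorem quad_nonneg {E : Type*} [NormedAddCommGroup E] [InnerProductSpace ℝ E] {a b c : ℝ}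
    (ha : 0 < a) (hd : 0 < a * c - b ^ 2) (p q : E) :
    0 ≤ a * inner ℝ p p + c * inner ℝ q q - b * (inner ℝ p q + inner ℝ q p) ∧
      (a * inner ℝ p p + c * inner ℝ q q - b * (inner ℝ p q + inner ℝ q p) = 0 →
        p = 0 ∧ q = 0) := by
  have h1 : 0 ≤ inner ℝ (a • p - b • q) (a • p - b • q) := real_inner_self_nonneg
  have h2 : 0 ≤ inner ℝ q q := real_inner_self_nonneg
  have e : inner ℝ (a • p - b • q) (a • p - b • q) + (a * c - b ^ 2) * inner ℝ q q
      = a * (a * inner ℝ p p + c * inner ℝ q q - b * (inner ℝ p q + inner ℝ q p)) := by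
    simp only [inner_sub_left, inner_sub_right, real_inner_smul_left, real_inner_smul_right]
    ring
  have h3 := mul_nonneg hd.le h2
  refine ⟨nonneg_of_mul_nonneg_right (by linarith : 0 ≤ a * _) ha, fun h => ?_⟩
  rw [h, mul_zero] at e
  have hq0 : (a * c - b ^ 2) * inner ℝ q q = 0 := by linarith
  have hq : q = 0 := inner_self_eq_zero.1 ((mul_eq_zero.1 hq0).resolve_left hd.ne')
  have hp0 : inner ℝ (a • p - b • q) (a • p - b • q) = 0 := by linarith
  have hp := inner_self_eq_zero.1 hp0
  rw [hq, smul_zero, sub_zero] at hp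
  exact ⟨(smul_eq_zero.1 hp).resolve_left ha.ne', hq⟩

theorem energyInner_self (x : EnergySpace P) :
    0 ≤ energyInner x x ∧ (energyInner x x = 0 → x = 0) := by
  have hA := P.Ap_pos
  have hμ := P.μ_pos
  have hε := P.ε_pos
  obtain ⟨hC, hC'⟩ := P.weighted_pos P.Cp_pos P.Cs_pos
  obtain ⟨hρ, hρ'⟩ := P.weighted_pos P.ρp_pos P.ρs_pos
  obtain ⟨n1, z1⟩ := quad_nonneg (b := P.CI0) (c := P.CI) hC hC' (weakDeriv x.x₁) (weakDeriv x.x₂)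
  obtain ⟨n2, z2⟩ := quad_nonneg (b := P.ρI0) (c := P.ρI) hρ hρ' x.x₄ x.x₅
  have k1 : 0 < 1 / P.μ * P.Ap := by positivity
  have k2 : 0 < P.ε * P.Ap := by positivity
  have m1 := mul_nonneg k1.le (real_inner_self_nonneg (x := weakDeriv x.x₃))
  have m2 := mul_nonneg k2.le (real_inner_self_nonneg (x := x.x₆))
  have e := energyInner_eq x x
  rw [← CA] at n1 z1
  rw [← ρA] at n2 z2
  refine ⟨by linarith, fun h => ?_⟩
  rw [h] at e
  obtain ⟨p1, p2⟩ := z1 (by linarith)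
  obtain ⟨p4, p5⟩ := z2 (by linarith)
  have q3 : 1 / P.μ * P.Ap * inner ℝ (weakDeriv x.x₃) (weakDeriv x.x₃) = 0 := by linarith
  have q6 : P.ε * P.Ap * inner ℝ x.x₆ x.x₆ = 0 := by linarith
  exact ext' (eq_zero_of_weakDeriv_eq_zero x.x₁_mem p1) (eq_zero_of_weakDeriv_eq_zero x.x₂_mem p2)
    (eq_zero_of_weakDeriv_eq_zero x.x₃_mem
      (inner_self_eq_zero.1 ((mul_eq_zero.1 q3).resolve_left k1.ne'))) p4 p5
    (inner_self_eq_zero.1 ((mul_eq_zero.1 q6).resolve_left k2.ne'))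

variable (P) in
/-- The energy inner product is an inner product. -/
@[reducible] def innerCore : InnerProductSpace.Core ℝ (EnergySpace P) where
  inner := energyInner
  conj_inner_symm x y := by
    simp only [energyInner, conj_trivial]
    congr 1
    funext z
    ring
  re_inner_nonneg x := (energyInner_self x).1
  add_left x y w := by
    simp only [energyInner_eq, add_x₁, add_x₂, add_x₃, add_x₄, add_x₅, add_x₆, inner_add_left,
      weakDeriv_add_of_mem x.x₁_mem y.x₁_mem, weakDeriv_add_of_mem x.x₂_mem y.x₂_mem,
      weakDeriv_add_of_mem x.x₃_mem y.x₃_mem]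
    ring
  smul_left x y c := by
    simp only [energyInner_eq, smul_x₁, smul_x₂, smul_x₃, smul_x₄, smul_x₅, smul_x₆,
      real_inner_smul_left, conj_trivial, weakDeriv_smul c x.x₁_mem.1, weakDeriv_smul c x.x₂_mem.1,
      weakDeriv_smul c x.x₃_mem.1]
    ring
  definite x h := (energyInner_self x).2 h

instance : NormedAddCommGroup (EnergySpace P) := (innerCore P).toNormedAddCommGroup

instance : InnerProductSpace ℝ (EnergySpace P) := InnerProductSpace.ofCore (innerCore P).toCore

end EnergySpace

/-! ### The operator -/

/-- The domain of the system operator: `x₁, x₂, x₃ ∈ H²(0,1) ∩ H¹₀(0,1)`,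
`x₄, x₅, x₆ ∈ H¹₀(0,1)`, together with the natural boundary conditions at `z = 1`:
`C_A x₁'(1) - C_{I_0} x₂'(1) - γ A^p x₆(1) = 0`, `C_I x₂'(1) - C_{I_0} x₁'(1) + γ I_0^p x₆(1) = 0`,
`(1/μ) A^p x₃'(1) = 0`. -/
def domainEB : Submodule ℝ (EnergySpace P) where
  carrier := {x |
    (weakDeriv x.x₁ ∈ H1 ∧ weakDeriv x.x₂ ∈ H1 ∧ weakDeriv x.x₃ ∈ H1) ∧
    (x.x₄ ∈ H10 ∧ x.x₅ ∈ H10 ∧ x.x₆ ∈ H10) ∧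
    HasValueAt (P.CA • weakDeriv x.x₁ - P.CI0 • weakDeriv x.x₂ - (P.γ * P.Ap) • x.x₆) 1 0 ∧
    HasValueAt (P.CI • weakDeriv x.x₂ - P.CI0 • weakDeriv x.x₁ + (P.γ * P.I0p) • x.x₆) 1 0 ∧
    HasValueAt ((1 / P.μ * P.Ap) • weakDeriv x.x₃) 1 0}
  add_mem' := by
    rintro x y ⟨⟨a1, a2, a3⟩, ⟨a4, a5, a6⟩, b1, b2, b3⟩ ⟨⟨c1, c2, c3⟩, ⟨c4, c5, c6⟩, d1, d2, d3⟩
    have e1 := weakDeriv_add x.x₁_mem.1 y.x₁_mem.1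
    have e2 := weakDeriv_add x.x₂_mem.1 y.x₂_mem.1
    have e3 := weakDeriv_add x.x₃_mem.1 y.x₃_mem.1
    simp only [mem_ofPred_eq, EnergySpace.add_x₁, EnergySpace.add_x₂, EnergySpace.add_x₃,
      EnergySpace.add_x₄, EnergySpace.add_x₅, EnergySpace.add_x₆, e1, e2, e3]
    refine ⟨⟨H1.add_mem a1 c1, H1.add_mem a2 c2, H1.add_mem a3 c3⟩,
      ⟨H10.add_mem a4 c4, H10.add_mem a5 c5, H10.add_mem a6 c6⟩, ?_, ?_, ?_⟩
    · convert b1.add d1 using 1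
      · module
      · simp
    · convert b2.add d2 using 1
      · module
      · simp
    · convert b3.add d3 using 1
      · module
      · simp
  zero_mem' := by
    have e : weakDeriv 0 = 0 := HasWeakDeriv.zero.weakDeriv_eq
    simp only [mem_ofPred_eq, EnergySpace.zero_x₁, EnergySpace.zero_x₂, EnergySpace.zero_x₃,
      EnergySpace.zero_x₄, EnergySpace.zero_x₅, EnergySpace.zero_x₆, e, smul_zero, sub_zero,
      add_zero]
    exact ⟨⟨H1.zero_mem, H1.zero_mem, H1.zero_mem⟩, ⟨H10.zero_mem, H10.zero_mem, H10.zero_mem⟩,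
      HasValueAt.zero 1, HasValueAt.zero 1, HasValueAt.zero 1⟩
  smul_mem' := by
    rintro c x ⟨⟨a1, a2, a3⟩, ⟨a4, a5, a6⟩, b1, b2, b3⟩
    have e1 := weakDeriv_smul c x.x₁_mem.1
    have e2 := weakDeriv_smul c x.x₂_mem.1
    have e3 := weakDeriv_smul c x.x₃_mem.1
    simp only [mem_ofPred_eq, EnergySpace.smul_x₁, EnergySpace.smul_x₂, EnergySpace.smul_x₃,
      EnergySpace.smul_x₄, EnergySpace.smul_x₅, EnergySpace.smul_x₆, e1, e2, e3]
    refine ⟨⟨H1.smul_mem c a1, H1.smul_mem c a2, H1.smul_mem c a3⟩,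
      ⟨H10.smul_mem c a4, H10.smul_mem c a5, H10.smul_mem c a6⟩, ?_, ?_, ?_⟩
    · convert b1.smul c using 1
      · module
      · simp
    · convert b2.smul c using 1
      · module
      · simp
    · convert b3.smul c using 1
      · module
      · simp

variable {P} in
/-- The operator matrix applied to a state in the domain: the first three components are
`x₄, x₅, x₆`, the last three are
`a₄₁ x₁'' - a₄₂ x₂'' - a₄₆ x₆'`, `- a₅₁ x₁'' + a₅₂ x₂'' + a₅₆ x₆'`, `a₆₃ x₃'' - a₆₄ x₄' + a₆₅ x₅'`. -/
def applyEB (x : P.domainEB) : EnergySpace P :=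
  EnergySpace.mk ⟨x.1.x₄, x.2.2.1.1⟩ ⟨x.1.x₅, x.2.2.1.2.1⟩ ⟨x.1.x₆, x.2.2.1.2.2⟩
    (P.a41 • weakDeriv (weakDeriv x.1.x₁) - P.a42 • weakDeriv (weakDeriv x.1.x₂)
      - P.a46 • weakDeriv x.1.x₆)
    (-P.a51 • weakDeriv (weakDeriv x.1.x₁) + P.a52 • weakDeriv (weakDeriv x.1.x₂)
      + P.a56 • weakDeriv x.1.x₆)
    (P.a63 • weakDeriv (weakDeriv x.1.x₃) - P.a64 • weakDeriv x.1.x₄ + P.a65 • weakDeriv x.1.x₅)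

/-- The system operator of the current-controlled piezoelectric composite with Euler–Bernoulli beam
theory, with zero input. -/
def operatorEB : EnergySpace P →ₗ.[ℝ] EnergySpace P where
  domain := P.domainEB
  toFun :=
    { toFun := applyEB
      map_add' := by
        rintro ⟨x, hx⟩ ⟨y, hy⟩
        obtain ⟨⟨a1, a2, a3⟩, ⟨a4, a5, a6⟩, -⟩ := id hx
        obtain ⟨⟨c1, c2, c3⟩, ⟨c4, c5, c6⟩, -⟩ := id hy
        apply EnergySpace.ext' <;>
        simp only [applyEB, EnergySpace.mk_x₁, EnergySpace.mk_x₂, EnergySpace.mk_x₃,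
          EnergySpace.mk_x₄, EnergySpace.mk_x₅, EnergySpace.mk_x₆, Submodule.coe_add,
          EnergySpace.add_x₁, EnergySpace.add_x₂, EnergySpace.add_x₃,
          EnergySpace.add_x₄, EnergySpace.add_x₅, EnergySpace.add_x₆,
          weakDeriv_add x.x₁_mem.1 y.x₁_mem.1, weakDeriv_add x.x₂_mem.1 y.x₂_mem.1,
          weakDeriv_add x.x₃_mem.1 y.x₃_mem.1, weakDeriv_add a1 c1, weakDeriv_add a2 c2,
          weakDeriv_add a3 c3, weakDeriv_add a4.1 c4.1, weakDeriv_add a5.1 c5.1,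
          weakDeriv_add a6.1 c6.1] <;> module
      map_smul' := by
        rintro c ⟨x, hx⟩
        obtain ⟨⟨a1, a2, a3⟩, ⟨a4, a5, a6⟩, -⟩ := id hx
        apply EnergySpace.ext' <;>
        simp only [applyEB, EnergySpace.mk_x₁, EnergySpace.mk_x₂, EnergySpace.mk_x₃,
          EnergySpace.mk_x₄, EnergySpace.mk_x₅, EnergySpace.mk_x₆, Submodule.coe_smul,
          EnergySpace.smul_x₁, EnergySpace.smul_x₂, EnergySpace.smul_x₃,
          EnergySpace.smul_x₄, EnergySpace.smul_x₅, EnergySpace.smul_x₆, RingHom.id_apply,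
          weakDeriv_smul c x.x₁_mem.1, weakDeriv_smul c x.x₂_mem.1,
          weakDeriv_smul c x.x₃_mem.1, weakDeriv_smul c a1, weakDeriv_smul c a2,
          weakDeriv_smul c a3, weakDeriv_smul c a4.1, weakDeriv_smul c a5.1,
          weakDeriv_smul c a6.1] <;> module }

end PiezoComposite

end

/-! With zero input nothing dissipates energy, so the operator `A` is skew for the energy inner
product. It is also onto, and on a Hilbert space these two facts suffice: no separate proof that the
domain is dense is needed.

Abstract part. If `A` is skew and surjective, then it is injective, and `B = A⁻¹` is everywhere
defined and skew. Hence `B` is bounded by a closed graph argument, and it has dense range. The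
generation theorem is stated for `B` alone: the Yosida approximations of `A` are the bounded
operators `(B - ε)⁻¹`, they are dissipative, and their exponentials are contractions which converge
on the dense range of `B²`, hence everywhere. That the generator is exactly `B⁻¹`, and not a proper
extension, follows because the semigroup commutes with `B` (`exists_contractionSemigroup`,
`LinearPMap.exists_contractionSemigroup_of_skew`).

Concrete part. Positivity of the determinants of the stiffness and mass matrices makes the energy
norm equivalent to the product norm of `(x₁', x₂', x₃', x₄, x₅, x₆)` in `L²(0,1)⁶`, whence
completeness. Multiplying the velocity rows of the operator by the mass matrix turns them into
derivatives of three resultants: normal force, bending moment and magnetic resultant. The boundary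
conditions say that these vanish at `1`, while the velocities vanish at `0`. Integration by parts
therefore leaves no boundary term, and the coupling terms in `γ` cancel (`inner_operatorEB_self`).
For surjectivity the resultants are found by integrating from `1`, the strains by inverting the
stiffness matrix, and the displacements by integrating from `0` (`operatorEB_surjective`). -/

noncomputable section
/-! ### Generation of contraction semigroups -/

section ContractionSemigroup

variable {H : Type*} [NormedAddCommGroup H] [InnerProductSpace ℝ H]

/-- A uniformly bounded family of operators converging to `0` pointwise on a dense set converges
to `0` pointwise. -/
theorem tendsto_zero_of_denseRange {ι α : Type*} {l : Filter ι} {u : ι → H →L[ℝ] H} {C : ℝ}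
    {d : α → H} (hd : DenseRange d) (hu : ∀ᶠ i in l, ∀ x, ‖u i x‖ ≤ C * ‖x‖)
    (h : ∀ a, Tendsto (fun i => u i (d a)) l (𝓝 0)) (x : H) :
    Tendsto (fun i => u i x) l (𝓝 0) := by
  rw [Metric.tendsto_nhds]
  intro δ hδ
  -- `|C| + 1` replaces `C` because the latter may be zero or negative.
  have hK : 0 < |C| + 1 := by positivity
  obtain ⟨a, ha⟩ := hd.exists_dist_lt x (ε := δ / 2 / (|C| + 1)) (by positivity)
  have ha' : ‖x - d a‖ * (|C| + 1) < δ / 2 := by rwa [dist_eq_norm, lt_div_iff₀ hK] at ha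
  filter_upwards [hu, (Metric.tendsto_nhds.1 (h a)) (δ / 2) (by positivity)] with i h1 h2
  rw [dist_zero_right] at h2 ⊢
  have e : u i x = u i (x - d a) + u i (d a) := by rw [map_sub]; abel
  have h3 := h1 (x - d a)
  have h4 : C * ‖x - d a‖ ≤ ‖x - d a‖ * (|C| + 1) := by
    nlinarith [le_abs_self C, norm_nonneg (x - d a)]
  calc ‖u i x‖ ≤ ‖u i (x - d a)‖ + ‖u i (d a)‖ := by rw [e]; exact norm_add_le _ _
    _ < δ := by linarith

theorem exp_smul_apply_comm {A B : H →L[ℝ] H} (h : Commute A B) (t : ℝ) (x : H) :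
    NormedSpace.exp (t • A) (B x) = B (NormedSpace.exp (t • A) x) :=
  DFunLike.congr_fun ((h.smul_left t).exp_left : _ * _ = _ * _) x

/-- The operator `(B - ε)⁻¹`: if `B = A⁻¹`, this is the Yosida approximation `A (1 - ε A)⁻¹`. -/
def yosida (B : H →L[ℝ] H) (ε : ℝ) : H →L[ℝ] H := Ring.inverse (B - ε • 1)

theorem commute_yosida (B : H →L[ℝ] H) (ε δ : ℝ) : Commute (yosida B ε) (yosida B δ) := by
  refine Commute.ringInverse_ringInverse (Commute.sub_left (Commute.sub_right ?_ ?_)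
    (Commute.sub_right ?_ ?_))
  · exact Commute.refl B
  · exact (Commute.one_right B).smul_right δ
  · exact (Commute.one_left B).smul_left ε
  · exact ((Commute.refl 1).smul_right δ).smul_left ε

variable [CompleteSpace H]

theorem hasDerivAt_exp_smul_apply (A : H →L[ℝ] H) (x : H) (t : ℝ) :
    HasDerivAt (fun s : ℝ => NormedSpace.exp (s • A) x) (A (NormedSpace.exp (t • A) x)) t :=
  (hasDerivAt_exp_smul_const' A t).clm_apply (hasDerivAt_const t x) |>.congr_deriv (by simp)

/-- A bounded dissipative operator generates contractions. -/
theorem norm_exp_smul_apply_le {A : H →L[ℝ] H} (hA : ∀ x, inner ℝ (A x) x ≤ 0) {t : ℝ}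
    (ht : 0 ≤ t) (x : H) : ‖NormedSpace.exp (t • A) x‖ ≤ ‖x‖ := by
  have hd := fun s => (hasDerivAt_exp_smul_apply A x s).norm_sq
  have hanti : Antitone fun s : ℝ => ‖NormedSpace.exp (s • A) x‖ ^ 2 := by
    refine antitone_of_deriv_nonpos (fun s => (hd s).differentiableAt) fun s => ?_
    rw [(hd s).deriv, real_inner_comm]
    have := hA (NormedSpace.exp (s • A) x)
    linarith
  have := hanti ht
  simp only [zero_smul, NormedSpace.exp_zero, one_apply_eq_self] at this
  exact (sq_le_sq₀ (norm_nonneg _) (norm_nonneg _)).1 this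

/-- The groups generated by commuting bounded dissipative operators depend on the generators in a
Lipschitz way. -/
theorem norm_exp_smul_sub_exp_smul_apply_le {A B : H →L[ℝ] H} (hA : ∀ x, inner ℝ (A x) x ≤ 0)
    (hB : ∀ x, inner ℝ (B x) x ≤ 0) (hAB : Commute A B) {t : ℝ} (ht : 0 ≤ t) (x : H) :
    ‖NormedSpace.exp (t • A) x - NormedSpace.exp (t • B) x‖ ≤ t * ‖A x - B x‖ := by
  -- Duhamel interpolation: `f` runs from `exp (t B) x` at `s = 0` to `exp (t A) x` at `s = t`. As
  -- `A` and `B` commute, its derivative is `A x - B x` moved by two contractions.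
  let f : ℝ → H := fun s => NormedSpace.exp (s • A) (NormedSpace.exp ((t - s) • B) x)
  have hf : ∀ s, HasDerivAt f
      (NormedSpace.exp (s • A) (NormedSpace.exp ((t - s) • B) (A x - B x))) s := by
    intro s
    have h1 := hasDerivAt_exp_smul_const' A s
    have h2 : HasDerivAt (fun r : ℝ => NormedSpace.exp ((t - r) • B) x)
        (-(B (NormedSpace.exp ((t - s) • B) x))) s := by
      simpa [Function.comp_def] using (hasDerivAt_exp_smul_apply B x (t - s)).scomp s
        ((hasDerivAt_id s).const_sub t)
    refine (h1.clm_apply h2).congr_deriv ?_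
    rw [map_sub, map_sub, exp_smul_apply_comm hAB.symm, exp_smul_apply_comm (Commute.refl B),
      exp_smul_apply_comm (Commute.refl A), map_neg, mul_apply_eq_comp,
      ← sub_eq_add_neg]
  have key := norm_image_sub_le_of_norm_deriv_le_segment' (a := 0) (b := t) (C := ‖A x - B x‖)
    (fun s _ => (hf s).hasDerivWithinAt)
    (fun s hs => (norm_exp_smul_apply_le hA hs.1 _).trans
      (norm_exp_smul_apply_le hB (sub_nonneg.2 hs.2.le) _)) t (right_mem_Icc.2 ht)
  simpa [f, mul_comm] using key

theorem norm_exp_smul_apply_sub_le {A : H →L[ℝ] H} (hA : ∀ x, inner ℝ (A x) x ≤ 0) {t : ℝ}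
    (ht : 0 ≤ t) (x : H) : ‖NormedSpace.exp (t • A) x - x‖ ≤ t * ‖A x‖ := by
  simpa using norm_exp_smul_sub_exp_smul_apply_le (B := 0) hA (by simp) (Commute.zero_right A) ht x

/-- Mean value inequality for `exp (s A) x - s y`, whose derivative splits as `exp (s A) (A x - y) +
(exp (s A) y - y)`. For `A` a Yosida approximation and `y` its limiting value at `x`, the bound is
uniform enough to pass to the limit and yields the generator. -/
theorem norm_exp_smul_apply_sub_sub_le {A : H →L[ℝ] H} (hA : ∀ x, inner ℝ (A x) x ≤ 0) {t : ℝ}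
    (ht : 0 ≤ t) (x y : H) :
    ‖NormedSpace.exp (t • A) x - x - t • y‖ ≤ (‖A x - y‖ + t * ‖A y‖) * t := by
  let f : ℝ → H := fun s => NormedSpace.exp (s • A) x - s • y
  have hf : ∀ s, HasDerivAt f (A (NormedSpace.exp (s • A) x) - y) s := fun s =>
    ((hasDerivAt_exp_smul_apply A x s).sub ((hasDerivAt_id s).smul_const y)).congr_deriv (by simp)
  have key := norm_image_sub_le_of_norm_deriv_le_segment' (a := 0) (b := t)
    (C := ‖A x - y‖ + t * ‖A y‖) (fun s _ => (hf s).hasDerivWithinAt) (fun s hs => ?_) t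
    (right_mem_Icc.2 ht)
  · simpa [f, sub_right_comm] using key
  · have e : A (NormedSpace.exp (s • A) x) - y
        = NormedSpace.exp (s • A) (A x - y) + (NormedSpace.exp (s • A) y - y) := by
      rw [map_sub, exp_smul_apply_comm (Commute.refl A)]
      abel
    rw [e]
    refine (norm_add_le _ _).trans (add_le_add (norm_exp_smul_apply_le hA hs.1 _) ?_)
    exact (norm_exp_smul_apply_sub_le hA hs.1 y).trans
      (mul_le_mul_of_nonneg_right hs.2.le (norm_nonneg _))

/-! ### Estimates for the Yosida approximations of the inverse of `B`. -/

section yosida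

variable {B : H →L[ℝ] H} (hB : ∀ x, inner ℝ (B x) x ≤ 0) {ε : ℝ} (hε : 0 < ε)

include hB hε

/-- Lax–Milgram: dissipativity of `B` makes the form `⟨(ε - B) v, w⟩` coercive with constant `ε`. -/
theorem isUnit_sub_smul_one : IsUnit (B - ε • 1) := by
  let b : H →L[ℝ] H →L[ℝ] ℝ := (innerSL ℝ).comp (ε • 1 - B)
  have hb : ∀ v w, b v w = inner ℝ ((ε • 1 - B) v) w := fun v w => rfl
  have hc : IsCoercive b := ⟨ε, hε, fun v => by
    have := hB v
    rw [hb, sub_apply, inner_sub_left, smul_apply,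
      real_inner_smul_left, one_apply_eq_self, real_inner_self_eq_norm_mul_norm]
    linarith⟩
  have e : (hc.continuousLinearEquivOfBilin : H →L[ℝ] H) = ε • 1 - B := by
    ext v
    exact (hc.unique_continuousLinearEquivOfBilin (hb v · |>.symm)).symm
  have hu : IsUnit (ε • 1 - B) := by
    rw [← e]
    exact ⟨ContinuousLinearEquiv.toUnit hc.continuousLinearEquivOfBilin, rfl⟩
  simpa using hu.neg

theorem apply_yosida (x : H) : B (yosida B ε x) = x + ε • yosida B ε x := by
  have := DFunLike.congr_fun (Ring.mul_inverse_cancel _ (isUnit_sub_smul_one hB hε)) x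
  simp only [mul_apply_eq_comp, sub_apply,
    smul_apply, one_apply_eq_self] at this
  rw [← sub_eq_iff_eq_add]
  exact this

theorem yosida_apply (x : H) : yosida B ε (B x) = x + ε • yosida B ε x := by
  have := DFunLike.congr_fun (Ring.inverse_mul_cancel _ (isUnit_sub_smul_one hB hε)) x
  simp only [mul_apply_eq_comp, sub_apply,
    smul_apply, one_apply_eq_self, map_sub, map_smul] at this
  rw [← sub_eq_iff_eq_add]
  exact this

/-- Dissipativity of `B` at the vector `yosida B ε x`, which `B` sends to `x + ε • yosida B ε x`.
The quadratic term is kept because, with Cauchy–Schwarz, it gives the resolvent bound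
`norm_smul_yosida_le`. -/
theorem inner_yosida_le (x : H) : inner ℝ (yosida B ε x) x ≤ - (ε * ‖yosida B ε x‖ ^ 2) := by
  have h := hB (yosida B ε x)
  rw [apply_yosida hB hε, inner_add_left, real_inner_smul_left, real_inner_self_eq_norm_sq] at h
  rw [real_inner_comm]
  linarith

theorem inner_yosida_nonpos (x : H) : inner ℝ (yosida B ε x) x ≤ 0 :=
  (inner_yosida_le hB hε x).trans (by rw [neg_nonpos]; positivity)

theorem norm_smul_yosida_le (x : H) : ‖ε • yosida B ε x‖ ≤ ‖x‖ := by
  have h1 := inner_yosida_le hB hε x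
  have h2 := neg_le_of_abs_le (abs_real_inner_le_norm (yosida B ε x) x)
  rw [norm_smul, Real.norm_of_nonneg hε.le]
  rcases (norm_nonneg (yosida B ε x)).eq_or_lt' with h0 | h0
  · rw [h0, mul_zero]
    exact norm_nonneg x
  · exact le_of_mul_le_mul_right (by linarith : _ ≤ ‖x‖ * ‖yosida B ε x‖) h0

theorem norm_yosida_apply_le (x : H) : ‖yosida B ε (B x)‖ ≤ 2 * ‖x‖ := by
  rw [yosida_apply hB hε]
  have := norm_add_le x (ε • yosida B ε x)
  have := norm_smul_yosida_le hB hε x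
  linarith

/-- The convergence rate of the approximations: on the range of `B²`, where the inverse of `B` takes
`B (B x)` to `B x`, the error is `ε • yosida B ε (B x)`, which is of order `ε`. -/
theorem norm_yosida_apply_apply_sub_le (x : H) :
    ‖yosida B ε (B (B x)) - B x‖ ≤ ε * (2 * ‖x‖) := by
  rw [yosida_apply hB hε (B x), add_sub_cancel_left, norm_smul, Real.norm_of_nonneg hε.le]
  exact mul_le_mul_of_nonneg_left (norm_yosida_apply_le hB hε x) hε.le

end yosida

theorem commute_yosida_self {B : H →L[ℝ] H} (hB : ∀ x, inner ℝ (B x) x ≤ 0) {ε : ℝ} (hε : 0 < ε) :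
    Commute (yosida B ε) B := by
  ext x
  exact (yosida_apply hB hε x).trans (apply_yosida hB hε x).symm

/-- The inverse of a bounded dissipative operator with dense range generates a strongly continuous
semigroup of contractions. -/
theorem exists_contractionSemigroup {B : H →L[ℝ] H} (hB : ∀ x, inner ℝ (B x) x ≤ 0)
    (hd : DenseRange B) :
    ∃ T : ℝ≥0 → H →L[ℝ] H, IsC0Semigroup T ∧ (∀ t, ‖T t‖ ≤ 1) ∧
      ∀ x y, x = B y ↔ Tendsto (fun t : ℝ≥0 => (t : ℝ)⁻¹ • (T t x - x)) (𝓝[>] 0) (𝓝 y) := by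
  let ε : ℕ → ℝ := fun n => 1 / ((n : ℝ) + 1)
  have hε : ∀ n, 0 < ε n := fun n => by positivity
  have hε0 : Tendsto ε atTop (𝓝 0) := tendsto_one_div_add_atTop_nhds_zero_nat
  let A : ℕ → H →L[ℝ] H := fun n => yosida B (ε n)
  have hA : ∀ n x, inner ℝ (A n x) x ≤ 0 := fun n => inner_yosida_nonpos hB (hε n)
  let E : ℕ → ℝ≥0 → H →L[ℝ] H := fun n t => NormedSpace.exp ((t : ℝ) • A n)
  have hE : ∀ n t x, ‖E n t x‖ ≤ ‖x‖ := fun n t x => norm_exp_smul_apply_le (hA n) t.2 x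
  have hcauchy : ∀ t x, CauchySeq fun n => E n t x := by
    intro t x
    rw [cauchySeq_iff_tendsto_dist_atTop_0]
    -- The range of `B²` is the dense set on which the approximate generators converge with a rate,
    -- and the Lipschitz bound carries this rate to the exponentials.
    have hdd : DenseRange fun z => B (B z) := hd.comp hd B.continuous
    have := tendsto_zero_of_denseRange (l := atTop) (u := fun p : ℕ × ℕ => E p.1 t - E p.2 t)
      (C := 2) hdd (Eventually.of_forall fun p x => ?_) (fun z => ?_) x
    · simpa [dist_eq_norm] using this.norm
    · have := norm_sub_le (E p.1 t x) (E p.2 t x)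
      have := hE p.1 t x
      have := hE p.2 t x
      rw [sub_apply]
      linarith
    · refine squeeze_zero_norm (a := fun p : ℕ × ℕ => t * (ε p.1 * (2 * ‖z‖) + ε p.2 * (2 * ‖z‖)))
        (fun p => ?_) ?_
      · refine (norm_exp_smul_sub_exp_smul_apply_le (hA p.1) (hA p.2) (commute_yosida B _ _)
          t.2 _).trans (mul_le_mul_of_nonneg_left ?_ t.2)
        have e : A p.1 (B (B z)) - A p.2 (B (B z))
          = (A p.1 (B (B z)) - B z) - (A p.2 (B (B z)) - B z) := by abel
        rw [e]
        exact (norm_sub_le _ _).trans (add_le_add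
          (norm_yosida_apply_apply_sub_le hB (hε p.1) z)
          (norm_yosida_apply_apply_sub_le hB (hε p.2) z))
      · rw [← prod_atTop_atTop_eq]
        have h1 := (hε0.comp (tendsto_fst (f := atTop) (g := (atTop : Filter ℕ)))).mul_const
          (2 * ‖z‖)
        have h2 := (hε0.comp (tendsto_snd (f := (atTop : Filter ℕ)) (g := atTop))).mul_const
          (2 * ‖z‖)
        simpa using (h1.add h2).const_mul (t : ℝ)
  choose f hf using fun t x => cauchySeq_tendsto_of_complete (hcauchy t x)
  let T : ℝ≥0 → H →L[ℝ] H := fun t =>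
    continuousLinearMapOfTendsto (fun n => E n t) (tendsto_pi_nhds.2 (hf t))
  have hT : ∀ t x, Tendsto (fun n => E n t x) atTop (𝓝 (T t x)) := hf
  have hT1 : ∀ t x, ‖T t x‖ ≤ ‖x‖ := fun t x =>
    le_of_tendsto (hT t x).norm (Eventually.of_forall fun n => hE n t x)
  have hT0 : T 0 = ContinuousLinearMap.id ℝ H := by
    ext x
    refine tendsto_nhds_unique (hT 0 x) ?_
    simp [E]
  have hTB : ∀ t x, T t (B x) = B (T t x) := fun t x => by
    refine tendsto_nhds_unique (hT t (B x)) ?_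
    refine ((B.continuous.tendsto _).comp (hT t x)).congr fun n => ?_
    exact (exp_smul_apply_comm (commute_yosida_self hB (hε n)) t x).symm
  have hTadd : ∀ s t, T (s + t) = (T s).comp (T t) := by
    intro s t
    ext x
    refine tendsto_nhds_unique (hT (s + t) x) ?_
    -- The argument of `E n s` also varies with `n`; contractivity removes the error made by
    -- replacing `E n t x` with its limit.
    have h1 : Tendsto (fun n => E n s (E n t x - T t x)) atTop (𝓝 0) :=
      squeeze_zero_norm (fun n => hE n s _) (by simpa using ((hT t x).sub_const (T t x)).norm)
    have h2 := h1.add (hT s (T t x))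
    rw [zero_add] at h2
    refine h2.congr fun n => ?_
    let _ : NormedAlgebra ℚ (H →L[ℝ] H) := NormedAlgebra.restrictScalars ℚ ℝ _
    have e : E n (s + t) = E n s * E n t := by
      simp only [E]
      rw [NNReal.coe_add, add_smul, NormedSpace.exp_add_of_commute]
      exact ((Commute.refl (A n)).smul_left _).smul_right _
    rw [e, map_sub, sub_add_cancel]
    rfl
  have hTB1 : ∀ t x, ‖T t (B x) - B x‖ ≤ t * (2 * ‖x‖) := fun t x =>
    le_of_tendsto ((hT t (B x)).sub_const _).norm (Eventually.of_forall fun n =>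
      (norm_exp_smul_apply_sub_le (hA n) t.2 (B x)).trans
        (mul_le_mul_of_nonneg_left (norm_yosida_apply_le hB (hε n) x) t.2))
  have hTBB : ∀ t x, ‖T t (B (B x)) - B (B x) - (t : ℝ) • B x‖ ≤ (t * (2 * ‖x‖)) * t := by
    intro t x
    have h1 : Tendsto (fun n => (ε n * (2 * ‖x‖) + t * (2 * ‖x‖)) * t) atTop
        (𝓝 ((t * (2 * ‖x‖)) * t)) := by
      simpa using ((hε0.mul_const (2 * ‖x‖)).add_const (t * (2 * ‖x‖) : ℝ)).mul_const (t : ℝ)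
    refine le_of_tendsto_of_tendsto (((hT t (B (B x))).sub_const _).sub_const _).norm h1
      (Eventually.of_forall fun n => ?_)
    refine (norm_exp_smul_apply_sub_sub_le (hA n) t.2 (B (B x)) (B x)).trans
      (mul_le_mul_of_nonneg_right (add_le_add ?_ ?_) t.2)
    · exact norm_yosida_apply_apply_sub_le hB (hε n) x
    · exact mul_le_mul_of_nonneg_left (norm_yosida_apply_le hB (hε n) x) t.2
  have htend : Tendsto (fun t : ℝ≥0 => (t : ℝ)) (𝓝[>] 0) (𝓝 0) :=
    (NNReal.continuous_coe.tendsto' 0 0 rfl).mono_left nhdsWithin_le_nhds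
  have hpos : ∀ᶠ t : ℝ≥0 in 𝓝[>] 0, 0 < (t : ℝ) := by
    filter_upwards [self_mem_nhdsWithin] with t ht using ht
  have hcont : ∀ x, Tendsto (fun t => T t x) (𝓝[>] 0) (𝓝 x) := by
    intro x
    have := tendsto_zero_of_denseRange (l := 𝓝[>] 0)
      (u := fun t : ℝ≥0 => T t - ContinuousLinearMap.id ℝ H) (C := 2) hd
      (Eventually.of_forall fun t x => ?_) (fun z => ?_) x
    · simpa using this.add_const x
    · have := norm_sub_le (T t x) x
      have := hT1 t x
      rw [sub_apply, ContinuousLinearMap.id_apply]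
      linarith
    · exact squeeze_zero_norm (fun t => hTB1 t z) (by simpa using htend.mul_const (2 * ‖z‖))
  -- For `y = B z` the quadratic estimate `hTBB` gives the limit. It extends to all `y` because the
  -- difference quotients at `B y` are bounded by `2 * ‖y‖`; subtracting the identity makes the
  -- constant `3`.
  have hgen : ∀ y, Tendsto (fun t : ℝ≥0 => (t : ℝ)⁻¹ • (T t (B y) - B y)) (𝓝[>] 0) (𝓝 y) := by
    intro y
    have := tendsto_zero_of_denseRange (l := 𝓝[>] 0)
      (u := fun t : ℝ≥0 => (t : ℝ)⁻¹ • ((T t).comp B - B) - ContinuousLinearMap.id ℝ H) (C := 3) hd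
      (hpos.mono fun t ht x => ?_) (fun z => ?_) y
    · simpa using this.add_const y
    · simp only [sub_apply, smul_apply,
        ContinuousLinearMap.comp_apply, ContinuousLinearMap.id_apply]
      have h1 : ‖(t : ℝ)⁻¹ • (T t (B x) - B x)‖ ≤ 2 * ‖x‖ := by
        rw [norm_smul, norm_inv, Real.norm_of_nonneg ht.le, inv_mul_le_iff₀ ht]
        exact hTB1 t x
      have := norm_sub_le ((t : ℝ)⁻¹ • (T t (B x) - B x)) x
      linarith
    · refine squeeze_zero_norm' (a := fun t : ℝ≥0 => t * (2 * ‖z‖)) (hpos.mono fun t ht => ?_)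
        (by simpa using htend.mul_const (2 * ‖z‖))
      simp only [sub_apply, smul_apply,
        ContinuousLinearMap.comp_apply, ContinuousLinearMap.id_apply]
      have e : (t : ℝ)⁻¹ • (T t (B (B z)) - B (B z)) - B z
          = (t : ℝ)⁻¹ • (T t (B (B z)) - B (B z) - (t : ℝ) • B z) := by
        rw [smul_sub _ _ ((t : ℝ) • B z), inv_smul_smul₀ ht.ne']
      rw [e, norm_smul, norm_inv, Real.norm_of_nonneg ht.le, inv_mul_le_iff₀ ht, mul_comm (t : ℝ)]
      exact hTBB t z
  refine ⟨T, ⟨hT0, hTadd, hcont⟩, fun t => ContinuousLinearMap.opNorm_le_bound _ zero_le_one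
    fun x => by simpa using hT1 t x, fun x y => ⟨fun h => h ▸ hgen y, fun h => ?_⟩⟩
  -- Converse inclusion: applying `B` to the quotients at `x` gives the quotients at `B x`, since `T
  -- t` commutes with `B`. The former tend to `B y` by assumption, the latter to `x` by `hgen`.
  refine tendsto_nhds_unique (hgen x) (((B.continuous.tendsto y).comp h).congr fun t => ?_)
  simp [hTB]

/-- A skew-symmetric surjective operator on a Hilbert space generates a strongly continuous
semigroup of contractions. -/
theorem LinearPMap.exists_contractionSemigroup_of_skew {A : H →ₗ.[ℝ] H}
    (hA : ∀ x : A.domain, inner ℝ (A x) (x : H) = 0) (hs : Function.Surjective A) :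
    ∃ T : ℝ≥0 → H →L[ℝ] H, IsC0Semigroup T ∧ IsGenerator A T ∧ ∀ t, ‖T t‖ ≤ 1 := by
  -- Polarization of the vanishing quadratic form.
  have hskew : ∀ x y : A.domain, inner ℝ (A x) (y : H) = - inner ℝ (x : H) (A y) := by
    intro x y
    have h := hA (x + y)
    rw [A.map_add, Submodule.coe_add, inner_add_left, inner_add_right, inner_add_right, hA x,
      hA y] at h
    rw [real_inner_comm (A y)]
    linarith
  have hinj : Function.Injective A.toFun := by
    rw [← LinearMap.ker_eq_bot, LinearMap.ker_eq_bot']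
    intro x hx
    -- Surjectivity takes the place of a dense domain: a kernel vector `x = A y` satisfies `⟨x, x⟩ =
    -- ⟨x, A y⟩ = -⟨A x, y⟩ = 0`.
    obtain ⟨y, hy⟩ := hs x
    have h := hskew x y
    rw [hy, show A x = 0 from hx, inner_zero_left, eq_comm, neg_eq_zero, inner_self_eq_zero] at h
    exact Subtype.ext h
  let e : A.domain ≃ₗ[ℝ] H := LinearEquiv.ofBijective A.toFun ⟨hinj, hs⟩
  have he : ∀ y, A (e.symm y) = y := fun y => e.apply_symm_apply y
  let B₀ : H →ₗ[ℝ] H := A.domain.subtype ∘ₗ (e.symm : H →ₗ[ℝ] A.domain)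
  have hB₀ : ∀ x y, inner ℝ (B₀ x) y = - inner ℝ x (B₀ y) := by
    intro x y
    have h := hskew (e.symm x) (e.symm y)
    rw [he, he] at h
    change inner ℝ ((e.symm x : A.domain) : H) y = - inner ℝ x ((e.symm y : A.domain) : H)
    linarith
  -- Hellinger–Toeplitz: an everywhere defined skew operator has closed graph. The pairing of `B₀ (u
  -- k) - B₀ x` with `y - B₀ x` tends to `‖y - B₀ x‖ ^ 2`, and to `0` after moving `B₀` to the other
  -- side.
  have hcont : Continuous B₀ := by
    refine B₀.continuous_of_seq_closed_graph fun u x y hu hTu => ?_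
    rw [← sub_eq_zero, ← inner_self_eq_zero (𝕜 := ℝ)]
    refine tendsto_nhds_unique ((hTu.sub_const (B₀ x)).inner tendsto_const_nhds) ?_
    have h := ((hu.sub_const x).inner (𝕜 := ℝ)
      (tendsto_const_nhds (x := B₀ (y - B₀ x)))).neg
    rw [sub_self, inner_zero_left, neg_zero] at h
    refine h.congr fun k => ?_
    rw [Function.comp_apply, ← hB₀, B₀.map_sub]
  let B : H →L[ℝ] H := ⟨B₀, hcont⟩
  have hB : ∀ x y, inner ℝ (B x) y = - inner ℝ x (B y) := hB₀
  have hd : DenseRange B := by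
    have : (B.range).topologicalClosure = ⊤ := by
      rw [Submodule.topologicalClosure_eq_top_iff, Submodule.eq_bot_iff]
      intro x hx
      -- For `x` orthogonal to the range, `⟨B x, B x⟩ = -⟨x, B (B x)⟩ = 0`; injectivity of the
      -- inverse then gives `x = 0`.
      have hBx : B x = 0 := by
        rw [← inner_self_eq_zero (𝕜 := ℝ), hB,
          (Submodule.mem_orthogonal' _ _).1 hx (B (B x)) ⟨B x, rfl⟩, neg_zero]
      have h2 : e.symm x = 0 := Subtype.ext hBx
      rw [← he x, h2, A.map_zero]
    exact Submodule.dense_iff_topologicalClosure_eq_top.2 this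
  obtain ⟨T, h1, h2, h3⟩ := exists_contractionSemigroup (B := B) (fun x => by
    have := hB x x
    rw [real_inner_comm (B x)] at this
    linarith) hd
  refine ⟨T, h1, fun x y => ?_, h2⟩
  rw [← h3, LinearPMap.mem_graph_iff]
  constructor
  · rintro ⟨z, hz, hz'⟩
    have : e.symm y = z := by rw [LinearEquiv.symm_apply_eq]; exact hz'.symm
    change x = ((e.symm y : A.domain) : H)
    rw [this]
    exact hz.symm
  · rintro rfl
    exact ⟨e.symm y, rfl, he y⟩

end ContractionSemigroup

end

noncomputable section
/-! ### Primitives and integration by parts on `(0,1)` -/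

namespace L2I

theorem intervalIntegrable (g : L2I) : IntervalIntegrable g volume 0 1 := by
  rw [intervalIntegrable_iff_integrableOn_Ioo_of_le zero_le_one]
  exact (Lp.memLp g).integrable (by norm_num)

/-- The primitive of `g` vanishing at `a`. -/
def primitiveFun (a : ℝ) (g : L2I) (z : ℝ) : ℝ := ∫ s in a..z, g s

theorem primitiveFun_self (a : ℝ) (g : L2I) : primitiveFun a g a = 0 :=
  intervalIntegral.integral_same

/-- Square integrable functions on a bounded interval are integrable, so their primitives are
absolutely continuous. This allows integration by parts although the derivative exists only almost
everywhere. -/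
theorem absolutelyContinuousOnInterval_primitiveFun {a : ℝ} (ha : a ∈ Icc (0 : ℝ) 1) (g : L2I) :
    AbsolutelyContinuousOnInterval (primitiveFun a g) 0 1 :=
  g.intervalIntegrable.absolutelyContinuousOnInterval_intervalIntegral
    (by rwa [uIcc_of_le zero_le_one])

theorem continuousOn_primitiveFun {a : ℝ} (ha : a ∈ Icc (0 : ℝ) 1) (g : L2I) :
    ContinuousOn (primitiveFun a g) (Icc 0 1) := by
  have := (absolutelyContinuousOnInterval_primitiveFun ha g).continuousOn
  rwa [uIcc_of_le zero_le_one] at this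

theorem ae_deriv_primitiveFun {a : ℝ} (ha : a ∈ Icc (0 : ℝ) 1) (g : L2I) :
    ∀ᵐ z, z ∈ Ioc (0 : ℝ) 1 → deriv (primitiveFun a g) z = g z := by
  filter_upwards [g.intervalIntegrable.ae_hasDerivAt_integral] with z hz hz'
  rw [uIcc_of_le zero_le_one] at hz
  exact (hz (Ioc_subset_Icc_self hz') a ha).deriv

theorem memLp_primitiveFun {a : ℝ} (ha : a ∈ Icc (0 : ℝ) 1) (g : L2I) :
    MemLp (primitiveFun a g) 2 (volume.restrict (Ioo (0 : ℝ) 1)) := by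
  have hc := continuousOn_primitiveFun ha g
  obtain ⟨C, hC⟩ := isCompact_Icc.exists_bound_of_continuousOn hc
  refine MemLp.of_bound ((hc.mono Ioo_subset_Icc_self).aestronglyMeasurable measurableSet_Ioo) C ?_
  filter_upwards [ae_restrict_mem measurableSet_Ioo] with z hz using hC z (Ioo_subset_Icc_self hz)

/-- The primitive of `g` vanishing at `a`, as an element of `L²(0,1)`. -/
def primitive {a : ℝ} (ha : a ∈ Icc (0 : ℝ) 1) (g : L2I) : L2I := (memLp_primitiveFun ha g).toLp _

variable {a : ℝ} (ha : a ∈ Icc (0 : ℝ) 1) (g : L2I)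

theorem coeFn_primitive :
    (primitive ha g : ℝ → ℝ) =ᵐ[volume.restrict (Ioo (0 : ℝ) 1)] primitiveFun a g :=
  MemLp.coeFn_toLp _

theorem hasValueAt_primitive : HasValueAt (primitive ha g) a 0 :=
  ⟨_, continuousOn_primitiveFun ha g, coeFn_primitive ha g, primitiveFun_self a g⟩

theorem setIntegral_Ioo_eq (f : ℝ → ℝ) : ∫ z in Ioo (0 : ℝ) 1, f z = ∫ z in (0 : ℝ)..1, f z := by
  rw [intervalIntegral.integral_of_le zero_le_one, integral_Ioc_eq_integral_Ioo]

theorem hasWeakDeriv_primitive : HasWeakDeriv (primitive ha g) g := by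
  intro φ h1 h2 h3
  have hφ : AbsolutelyContinuousOnInterval φ 0 1 :=
    ContDiffOn.absolutelyContinuousOnInterval (h1.of_le (by norm_cast)).contDiffOn
  have h0 : ∀ b ∉ Ioo (0 : ℝ) 1, φ b = 0 := fun b hb =>
    image_eq_zero_of_notMem_tsupport fun h => hb (h3 h)
  have key := (absolutelyContinuousOnInterval_primitiveFun ha g).integral_mul_deriv_eq_deriv_mul hφ
  rw [h0 0 (by simp), h0 1 (by simp), mul_zero, mul_zero, sub_zero, zero_sub] at key
  have e1 : ∫ z in Ioo (0 : ℝ) 1, primitive ha g z * deriv φ z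
      = ∫ z in (0 : ℝ)..1, primitiveFun a g z * deriv φ z := by
    rw [← setIntegral_Ioo_eq]
    refine integral_congr_ae ?_
    filter_upwards [coeFn_primitive ha g] with z hz
    rw [hz]
  rw [e1, key, setIntegral_Ioo_eq]
  congr 1
  refine intervalIntegral.integral_congr_ae ?_
  filter_upwards [ae_deriv_primitiveFun ha g] with z hz hz'
  rw [uIoc_of_le zero_le_one] at hz'
  rw [hz hz']

theorem primitive_mem_H1 : primitive ha g ∈ H1 := ⟨g, hasWeakDeriv_primitive ha g⟩

theorem weakDeriv_primitive : weakDeriv (primitive ha g) = g :=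
  (hasWeakDeriv_primitive ha g).weakDeriv_eq

theorem inner_eq_integral (u v : L2I) : inner ℝ u v = ∫ z in Ioo (0 : ℝ) 1, u z * v z := by
  rw [L2.inner_def]
  refine integral_congr_ae (Eventually.of_forall fun z => ?_)
  simp [mul_comm]

/-- Integration by parts for primitives vanishing at opposite end points. -/
theorem inner_primitive_left (g h : L2I) :
    inner ℝ (primitive (left_mem_Icc.2 zero_le_one) g) h
      = - inner ℝ g (primitive (right_mem_Icc.2 zero_le_one) h) := by
  have hl : (0 : ℝ) ∈ Icc (0 : ℝ) 1 := left_mem_Icc.2 zero_le_one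
  have hr : (1 : ℝ) ∈ Icc (0 : ℝ) 1 := right_mem_Icc.2 zero_le_one
  have key := (absolutelyContinuousOnInterval_primitiveFun hl
    g).integral_mul_deriv_eq_deriv_mul (absolutelyContinuousOnInterval_primitiveFun hr h)
  rw [primitiveFun_self, primitiveFun_self, mul_zero, zero_mul, sub_zero, zero_sub] at key
  have e1 : inner ℝ (primitive hl g) h
      = ∫ z in (0 : ℝ)..1, primitiveFun 0 g z * deriv (primitiveFun 1 h) z := by
    rw [inner_eq_integral, ← setIntegral_Ioo_eq]
    refine integral_congr_ae ?_
    filter_upwards [coeFn_primitive hl g, ae_restrict_of_ae (ae_deriv_primitiveFun hr h),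
      ae_restrict_mem measurableSet_Ioo] with z h1 h2 h3
    rw [h1, h2 (Ioo_subset_Ioc_self h3)]
  have e2 : inner ℝ g (primitive hr h)
      = ∫ z in (0 : ℝ)..1, deriv (primitiveFun 0 g) z * primitiveFun 1 h z := by
    rw [inner_eq_integral, ← setIntegral_Ioo_eq]
    refine integral_congr_ae ?_
    filter_upwards [coeFn_primitive hr h, ae_restrict_of_ae (ae_deriv_primitiveFun hl g),
      ae_restrict_mem measurableSet_Ioo] with z h1 h2 h3
    rw [h1, h2 (Ioo_subset_Ioc_self h3)]
  rw [e1, e2, key]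

/-- A function in `H¹(0,1)` vanishing at `a` is the primitive of its derivative. -/
theorem _root_.HasWeakDeriv.eq_primitive {u g : L2I} (hu : HasWeakDeriv u g)
    (hu' : HasValueAt u a 0) : u = primitive ha g := by
  have hw : HasWeakDeriv (u + (-1 : ℝ) • primitive ha g) 0 := by
    simpa using hu.add ((hasWeakDeriv_primitive ha g).smul (-1))
  obtain ⟨c, hc⟩ := hw.eq_const
  obtain ⟨f, f1, f2, f3⟩ := hu'.add ((hasValueAt_primitive ha g).smul (-1))
  have h1 : (fun _ : ℝ => c) =ᵐ[volume.restrict (Icc (0 : ℝ) 1)] f := by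
    rw [← restrict_Ioo_eq_restrict_Icc]
    exact hc.symm.trans f2
  -- Two continuous functions equal almost everywhere on `[0,1]` agree at `a` too, even if `a` is an
  -- end point; so the constant equals the boundary value `0`.
  have h2 := Measure.eqOn_Icc_of_ae_eq volume zero_ne_one h1 continuousOn_const f1 ha
  rw [f3] at h2
  simp only [mul_zero, add_zero] at h2
  have h3 : u + (-1 : ℝ) • primitive ha g = 0 := by
    rw [Lp.eq_zero_iff_ae_eq_zero]
    filter_upwards [hc] with z hz
    rw [hz]
    exact h2
  rwa [neg_one_smul, ← sub_eq_add_neg, sub_eq_zero] at h3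

/-- Integration by parts for `u(0) = 0` and `v(1) = 0`. -/
theorem inner_weakDeriv_add_inner_weakDeriv {u v : L2I} (hu : u ∈ H10) (hv : v ∈ H1)
    (hv' : HasValueAt v 1 0) : inner ℝ (weakDeriv u) v + inner ℝ u (weakDeriv v) = 0 := by
  have h1 := (hasWeakDeriv_weakDeriv hu.1).eq_primitive (left_mem_Icc.2 zero_le_one) hu.2
  have h2 := (hasWeakDeriv_weakDeriv hv).eq_primitive (right_mem_Icc.2 zero_le_one) hv'
  have h3 := inner_primitive_left (weakDeriv u) (weakDeriv v)
  rw [← h1, ← h2] at h3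
  linarith

theorem primitive_zero_mem_H10 (g : L2I) :
    primitive (left_mem_Icc.2 zero_le_one) g ∈ H10 :=
  ⟨primitive_mem_H1 _ g, hasValueAt_primitive _ g⟩

end L2I

/-- The weak derivative is a linear equivalence of `H¹₀(0,1)` with `L²(0,1)`. -/
def weakDerivEquiv : H10 ≃ₗ[ℝ] L2I where
  toFun u := weakDeriv u
  map_add' u v := weakDeriv_add u.2.1 v.2.1
  map_smul' c u := weakDeriv_smul c u.2.1
  invFun g := ⟨_, L2I.primitive_zero_mem_H10 g⟩
  left_inv u := Subtype.ext
    ((hasWeakDeriv_weakDeriv u.2.1).eq_primitive (left_mem_Icc.2 zero_le_one) u.2.2).symm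
  right_inv g := L2I.weakDeriv_primitive (left_mem_Icc.2 zero_le_one) g

@[simp] theorem weakDeriv_weakDerivEquiv_symm (g : L2I) :
    weakDeriv (weakDerivEquiv.symm g) = g := weakDerivEquiv.apply_symm_apply g

end

/-! ### Positivity of the stiffness and mass matrices. -/

noncomputable section
namespace PiezoComposite

theorem CA_pos (P : PiezoComposite) : 0 < P.CA := (P.weighted_pos P.Cp_pos P.Cs_pos).1

theorem C_det_pos (P : PiezoComposite) : 0 < P.CA * P.CI - P.CI0 ^ 2 :=
  (P.weighted_pos P.Cp_pos P.Cs_pos).2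

theorem ρA_pos (P : PiezoComposite) : 0 < P.ρA := (P.weighted_pos P.ρp_pos P.ρs_pos).1

theorem Δ_pos (P : PiezoComposite) : 0 < P.Δ := (P.weighted_pos P.ρp_pos P.ρs_pos).2

/-! ### Completeness of the energy space -/

namespace EnergySpace

variable {P : PiezoComposite}

theorem inner_eq_energyInner (x y : EnergySpace P) : inner ℝ x y = energyInner x y := rfl

/-- A positive definite quadratic form in two vectors. -/
def quadForm {E : Type*} [NormedAddCommGroup E] [InnerProductSpace ℝ E] (a b c : ℝ) (p q : E) : ℝ :=
  a * inner ℝ p p + c * inner ℝ q q - b * (inner ℝ p q + inner ℝ q p)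

/-- Completing the square: `a` times the form equals `‖a p - b q‖ ^ 2 + (a c - b ^ 2) ‖q‖ ^ 2`. This
bounds `q`; exchanging the two vectors bounds `p`. -/
theorem quadForm_coercive {E : Type*} [NormedAddCommGroup E] [InnerProductSpace ℝ E] {a b c : ℝ}
    (hd : 0 < a * c - b ^ 2) (p q : E) :
    ‖p‖ ^ 2 ≤ c / (a * c - b ^ 2) * quadForm a b c p q ∧
      ‖q‖ ^ 2 ≤ a / (a * c - b ^ 2) * quadForm a b c p q := by
  have key : ∀ (a c : ℝ) (p q : E), 0 < a * c - b ^ 2 →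
      ‖q‖ ^ 2 ≤ a / (a * c - b ^ 2) * quadForm a b c p q := by
    intro a c p q hd
    rw [div_mul_eq_mul_div, le_div_iff₀ hd]
    have h1 : 0 ≤ inner ℝ (a • p - b • q) (a • p - b • q) := real_inner_self_nonneg
    have e : inner ℝ (a • p - b • q) (a • p - b • q) + (a * c - b ^ 2) * inner ℝ q q
        = a * quadForm a b c p q := by
      simp only [quadForm, inner_sub_left, inner_sub_right, real_inner_smul_left,
        real_inner_smul_right]
      ring
    rw [real_inner_self_eq_norm_sq q] at e
    linarith
  refine ⟨?_, key a c p q hd⟩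
  have h := key c a q p (by linarith)
  rwa [mul_comm c a, show quadForm c b a q p = quadForm a b c p q by unfold quadForm; ring] at h

theorem norm_sq_eq (x : EnergySpace P) : ‖x‖ ^ 2 =
    quadForm P.CA P.CI0 P.CI (weakDeriv x.x₁) (weakDeriv x.x₂)
      + quadForm P.ρA P.ρI0 P.ρI x.x₄ x.x₅
      + 1 / P.μ * P.Ap * ‖weakDeriv x.x₃‖ ^ 2 + P.ε * P.Ap * ‖x.x₆‖ ^ 2 := by
  rw [← real_inner_self_eq_norm_sq, inner_eq_energyInner, energyInner_eq, quadForm, quadForm,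
    real_inner_self_eq_norm_sq (weakDeriv x.x₃), real_inner_self_eq_norm_sq x.x₆]
  ring

variable (P) in
/-- The energy space in the coordinates `(x₁', x₂', x₃', x₄, x₅, x₆)`. -/
def coordEquiv : EnergySpace P ≃ₗ[ℝ] L2I × L2I × L2I × L2I × L2I × L2I where
  toFun x := (weakDeriv x.x₁, weakDeriv x.x₂, weakDeriv x.x₃, x.x₄, x.x₅, x.x₆)
  map_add' x y := by
    simp only [add_x₁, add_x₂, add_x₃, add_x₄, add_x₅, add_x₆,
      weakDeriv_add_of_mem x.x₁_mem y.x₁_mem, weakDeriv_add_of_mem x.x₂_mem y.x₂_mem,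
      weakDeriv_add_of_mem x.x₃_mem y.x₃_mem, Prod.mk_add_mk]
  map_smul' c x := by
    simp only [smul_x₁, smul_x₂, smul_x₃, smul_x₄, smul_x₅, smul_x₆,
      weakDeriv_smul c x.x₁_mem.1, weakDeriv_smul c x.x₂_mem.1,
      weakDeriv_smul c x.x₃_mem.1, RingHom.id_apply, Prod.smul_mk]
  invFun g := mk (weakDerivEquiv.symm g.1) (weakDerivEquiv.symm g.2.1)
    (weakDerivEquiv.symm g.2.2.1) g.2.2.2.1 g.2.2.2.2.1 g.2.2.2.2.2
  left_inv x := Prod.ext (weakDerivEquiv.symm_apply_apply x.1)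
    (Prod.ext (weakDerivEquiv.symm_apply_apply x.2.1)
      (Prod.ext (weakDerivEquiv.symm_apply_apply x.2.2.1) rfl))
  right_inv g := by simp

theorem continuous_coordEquiv_symm : Continuous (coordEquiv P).symm := by
  refine continuous_of_continuousAt_zero (coordEquiv P).symm ?_
  rw [ContinuousAt, map_zero, tendsto_zero_iff_norm_tendsto_zero]
  -- The squared energy norm is an explicit continuous function of the coordinates, so continuity at
  -- `0` is proved for the square and a root is taken afterwards.
  have h : Tendsto (fun g => ‖(coordEquiv P).symm g‖ ^ 2) (𝓝 0) (𝓝 0) := by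
    have e : ∀ g, ‖(coordEquiv P).symm g‖ ^ 2 = quadForm P.CA P.CI0 P.CI g.1 g.2.1
        + quadForm P.ρA P.ρI0 P.ρI g.2.2.2.1 g.2.2.2.2.1
        + 1 / P.μ * P.Ap * ‖g.2.2.1‖ ^ 2 + P.ε * P.Ap * ‖g.2.2.2.2.2‖ ^ 2 := by
      intro g
      exact (norm_sq_eq (mk (weakDerivEquiv.symm g.1) (weakDerivEquiv.symm g.2.1)
        (weakDerivEquiv.symm g.2.2.1) g.2.2.2.1 g.2.2.2.2.1 g.2.2.2.2.2)).trans (by simp)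
    simp only [e, quadForm]
    refine Continuous.tendsto' (by fun_prop) _ _ (by simp)
  simpa using h.sqrt

theorem continuous_of_norm_sq_le {X E : Type*} [NormedAddCommGroup X] [NormedSpace ℝ X]
    [NormedAddCommGroup E] [NormedSpace ℝ E] (f : X →ₗ[ℝ] E) (K : ℝ)
    (h : ∀ x, ‖f x‖ ^ 2 ≤ K * ‖x‖ ^ 2) : Continuous f := by
  refine AddMonoidHomClass.continuous_of_bound f √K fun x => ?_
  have := Real.sqrt_le_sqrt (h x)
  rwa [Real.sqrt_sq (norm_nonneg _), Real.sqrt_mul' _ (sq_nonneg _),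
    Real.sqrt_sq (norm_nonneg _)] at this

theorem continuous_coordEquiv : Continuous (coordEquiv P) := by
  have hμ := P.μ_pos
  have hε := P.ε_pos
  have hA := P.Ap_pos
  have k3 : 0 < 1 / P.μ * P.Ap := by positivity
  have k6 : 0 < P.ε * P.Ap := by positivity
  have hC : ∀ p q : L2I, 0 ≤ quadForm P.CA P.CI0 P.CI p q :=
    fun p q => (quad_nonneg P.CA_pos P.C_det_pos p q).1
  have hρ : ∀ p q : L2I, 0 ≤ quadForm P.ρA P.ρI0 P.ρI p q :=
    fun p q => (quad_nonneg P.ρA_pos P.Δ_pos p q).1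
  -- From `P.CA * P.CI > P.CI0 ^ 2 ≥ 0` and `P.CA > 0`; the same argument serves for `P.ρI`.
  have hCI : 0 ≤ P.CI := by nlinarith [P.CA_pos, P.C_det_pos, sq_nonneg P.CI0]
  have hρI : 0 ≤ P.ρI := by
    have := P.Δ_pos
    unfold Δ at this
    nlinarith [P.ρA_pos, sq_nonneg P.ρI0]
  let π := (coordEquiv P : EnergySpace P →ₗ[ℝ] L2I × L2I × L2I × L2I × L2I × L2I)
  have bC : ∀ x : EnergySpace P,
      quadForm P.CA P.CI0 P.CI (weakDeriv x.x₁) (weakDeriv x.x₂) ≤ ‖x‖ ^ 2 ∧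
      quadForm P.ρA P.ρI0 P.ρI x.x₄ x.x₅ ≤ ‖x‖ ^ 2 ∧
      1 / P.μ * P.Ap * ‖weakDeriv x.x₃‖ ^ 2 ≤ ‖x‖ ^ 2 ∧
      P.ε * P.Ap * ‖x.x₆‖ ^ 2 ≤ ‖x‖ ^ 2 := by
    intro x
    have e := norm_sq_eq x
    have h1 := hC (weakDeriv x.x₁) (weakDeriv x.x₂)
    have h2 := hρ x.x₄ x.x₅
    have h3 : 0 ≤ 1 / P.μ * P.Ap * ‖weakDeriv x.x₃‖ ^ 2 := by positivity
    have h4 : 0 ≤ P.ε * P.Ap * ‖x.x₆‖ ^ 2 := by positivity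
    refine ⟨?_, ?_, ?_, ?_⟩ <;> linarith
  have c1 := continuous_of_norm_sq_le ((LinearMap.fst ℝ _ _) ∘ₗ π) (P.CI / (P.CA * P.CI - P.CI0 ^ 2))
    fun x => (quadForm_coercive P.C_det_pos _ _).1.trans
      (mul_le_mul_of_nonneg_left (bC x).1 (div_nonneg hCI P.C_det_pos.le))
  have c2 := continuous_of_norm_sq_le ((LinearMap.fst ℝ _ _) ∘ₗ (LinearMap.snd ℝ _ _) ∘ₗ π)
    (P.CA / (P.CA * P.CI - P.CI0 ^ 2))
    fun x => (quadForm_coercive P.C_det_pos _ _).2.trans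
      (mul_le_mul_of_nonneg_left (bC x).1 (div_nonneg P.CA_pos.le P.C_det_pos.le))
  have c3 := continuous_of_norm_sq_le ((LinearMap.fst ℝ _ _) ∘ₗ (LinearMap.snd ℝ _ _) ∘ₗ
      (LinearMap.snd ℝ _ _) ∘ₗ π) (1 / P.μ * P.Ap)⁻¹
    fun x => (le_inv_mul_iff₀ k3).2 (bC x).2.2.1
  have c4 := continuous_of_norm_sq_le ((LinearMap.fst ℝ _ _) ∘ₗ (LinearMap.snd ℝ _ _) ∘ₗ
      (LinearMap.snd ℝ _ _) ∘ₗ (LinearMap.snd ℝ _ _) ∘ₗ π) (P.ρI / (P.ρA * P.ρI - P.ρI0 ^ 2))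
    fun x => (quadForm_coercive P.Δ_pos _ _).1.trans
      (mul_le_mul_of_nonneg_left (bC x).2.1 (div_nonneg hρI P.Δ_pos.le))
  have c5 := continuous_of_norm_sq_le ((LinearMap.fst ℝ _ _) ∘ₗ (LinearMap.snd ℝ _ _) ∘ₗ
      (LinearMap.snd ℝ _ _) ∘ₗ (LinearMap.snd ℝ _ _) ∘ₗ (LinearMap.snd ℝ _ _) ∘ₗ π)
    (P.ρA / (P.ρA * P.ρI - P.ρI0 ^ 2))
    fun x => (quadForm_coercive P.Δ_pos _ _).2.trans
      (mul_le_mul_of_nonneg_left (bC x).2.1 (div_nonneg P.ρA_pos.le P.Δ_pos.le))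
  have c6 := continuous_of_norm_sq_le ((LinearMap.snd ℝ _ _) ∘ₗ (LinearMap.snd ℝ _ _) ∘ₗ
      (LinearMap.snd ℝ _ _) ∘ₗ (LinearMap.snd ℝ _ _) ∘ₗ (LinearMap.snd ℝ _ _) ∘ₗ π)
    (P.ε * P.Ap)⁻¹ fun x => (le_inv_mul_iff₀ k6).2 (bC x).2.2.2
  exact c1.prodMk (c2.prodMk (c3.prodMk (c4.prodMk (c5.prodMk c6))))

/-- The coordinate map is not an isometry for the product norm, but a linear homeomorphism is
uniform in both directions, so completeness transfers from `L²(0,1)⁶`. -/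
instance : CompleteSpace (EnergySpace P) := by
  let e : EnergySpace P ≃L[ℝ] L2I × L2I × L2I × L2I × L2I × L2I :=
    ⟨coordEquiv P, continuous_coordEquiv, continuous_coordEquiv_symm⟩
  exact (completeSpace_congr (e := e.toEquiv) e.isUniformEmbedding).2 inferInstance

end EnergySpace

/-! ### The operator is skew-symmetric and surjective -/

variable (P : PiezoComposite)

/-! ### The mass matrix times the coefficients of the operator. -/

theorem ρA_mul_a41_add : P.ρA * P.a41 + P.ρI0 * P.a51 = P.CA := by
  have := P.Δ_pos.ne'
  unfold a41 a51
  field_simp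
  unfold Δ
  ring

theorem ρA_mul_a42_add : P.ρA * P.a42 + P.ρI0 * P.a52 = P.CI0 := by
  have := P.Δ_pos.ne'
  unfold a42 a52
  field_simp
  unfold Δ
  ring

theorem ρA_mul_a46_add : P.ρA * P.a46 + P.ρI0 * P.a56 = P.γ * P.Ap := by
  have := P.Δ_pos.ne'
  unfold a46 a56
  field_simp
  unfold Δ
  ring

theorem ρI_mul_a51_add : P.ρI * P.a51 + P.ρI0 * P.a41 = P.CI0 := by
  have := P.Δ_pos.ne'
  unfold a41 a51
  field_simp
  unfold Δ
  ring

theorem ρI_mul_a52_add : P.ρI * P.a52 + P.ρI0 * P.a42 = P.CI := by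
  have := P.Δ_pos.ne'
  unfold a42 a52
  field_simp
  unfold Δ
  ring

theorem ρI_mul_a56_add : P.ρI * P.a56 + P.ρI0 * P.a46 = P.γ * P.I0p := by
  have := P.Δ_pos.ne'
  unfold a46 a56
  field_simp
  unfold Δ
  ring

theorem mul_a63 : P.ε * P.Ap * P.a63 = 1 / P.μ * P.Ap := by
  have := P.ε_pos.ne'
  have := P.μ_pos.ne'
  unfold a63
  field_simp

theorem mul_a64 : P.ε * P.Ap * P.a64 = P.γ * P.Ap := by
  have := P.ε_pos.ne'
  unfold a64
  field_simp

theorem mul_a65 : P.ε * P.Ap * P.a65 = P.γ * P.I0p := by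
  have := P.ε_pos.ne'
  have := P.Ap_pos.ne'
  unfold a65
  field_simp

variable {P}

/-- The normal force resultant `C_A x₁' - C_{I_0} x₂' - γ A^p x₆`. -/
def normalForce (x : EnergySpace P) : L2I :=
  P.CA • weakDeriv x.x₁ - P.CI0 • weakDeriv x.x₂ - (P.γ * P.Ap) • x.x₆

/-- The bending moment `C_I x₂' - C_{I_0} x₁' + γ I_0^p x₆`. -/
def bendingMoment (x : EnergySpace P) : L2I :=
  P.CI • weakDeriv x.x₂ - P.CI0 • weakDeriv x.x₁ + (P.γ * P.I0p) • x.x₆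

/-- The magnetic resultant `(1/μ) A^p x₃'`. -/
def magneticResultant (x : EnergySpace P) : L2I := (1 / P.μ * P.Ap) • weakDeriv x.x₃

/-- Momentum balance. The fourth and fifth rows of the operator are the inverse mass matrix applied
to the derivatives of the normal force and the bending moment; the coefficient identities undo that
inverse. -/
theorem hasWeakDeriv_normalForce (x : P.domainEB) :
    HasWeakDeriv (normalForce x.1) (P.ρA • (applyEB x).x₄ - P.ρI0 • (applyEB x).x₅) := by
  obtain ⟨⟨h1, h2, h3⟩, ⟨h4, h5, h6⟩, -⟩ := id x.2
  convert (((hasWeakDeriv_weakDeriv h1).smul P.CA).add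
    ((hasWeakDeriv_weakDeriv h2).smul (-P.CI0))).add
    ((hasWeakDeriv_weakDeriv h6.1).smul (-(P.γ * P.Ap))) using 1
  · unfold normalForce
    module
  · simp only [applyEB, EnergySpace.mk_x₄, EnergySpace.mk_x₅]
    rw [← P.ρA_mul_a41_add, ← P.ρA_mul_a42_add, ← P.ρA_mul_a46_add]
    module

theorem hasWeakDeriv_bendingMoment (x : P.domainEB) :
    HasWeakDeriv (bendingMoment x.1) (P.ρI • (applyEB x).x₅ - P.ρI0 • (applyEB x).x₄) := by
  obtain ⟨⟨h1, h2, h3⟩, ⟨h4, h5, h6⟩, -⟩ := id x.2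
  convert (((hasWeakDeriv_weakDeriv h2).smul P.CI).add
    ((hasWeakDeriv_weakDeriv h1).smul (-P.CI0))).add
    ((hasWeakDeriv_weakDeriv h6.1).smul (P.γ * P.I0p)) using 1
  · unfold bendingMoment
    module
  · simp only [applyEB, EnergySpace.mk_x₄, EnergySpace.mk_x₅]
    rw [← P.ρI_mul_a51_add, ← P.ρI_mul_a52_add, ← P.ρI_mul_a56_add]
    module

/-- The sixth row of the operator multiplied by `ε A^p` and solved for the term in `x₃''`. -/
theorem hasWeakDeriv_magneticResultant (x : P.domainEB) :
    HasWeakDeriv (magneticResultant x.1) ((P.ε * P.Ap) • (applyEB x).x₆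
      + (P.γ * P.Ap) • weakDeriv x.1.x₄ - (P.γ * P.I0p) • weakDeriv x.1.x₅) := by
  convert (hasWeakDeriv_weakDeriv x.2.1.2.2).smul (1 / P.μ * P.Ap) using 1
  · rfl
  · simp only [applyEB, EnergySpace.mk_x₆]
    rw [← P.mul_a63, ← P.mul_a64, ← P.mul_a65]
    module

/-- Energy conservation. Each velocity vanishes at `0` and its conjugate resultant at `1`, so the
three integrations by parts have no boundary terms. In their sum, the products of `x₆` with `x₄'`
and `x₅'` coming from the two mechanical resultants cancel those in the derivative of the magnetic
one. -/
theorem inner_operatorEB_self (x : P.domainEB) :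
    inner ℝ (P.operatorEB x) (x : EnergySpace P) = 0 := by
  obtain ⟨-, ⟨h4, h5, h6⟩, b1, b2, b3⟩ := id x.2
  have ibp : ∀ {u v g : L2I}, u ∈ H10 → HasWeakDeriv v g → HasValueAt v 1 0 →
      inner ℝ (weakDeriv u) v + inner ℝ g u = 0 := by
    intro u v g hu hv hv'
    have := L2I.inner_weakDeriv_add_inner_weakDeriv hu ⟨g, hv⟩ hv'
    rwa [hv.weakDeriv_eq, real_inner_comm g u] at this
  have i1 := ibp h4 (hasWeakDeriv_normalForce x) b1
  have i2 := ibp h5 (hasWeakDeriv_bendingMoment x) b2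
  have i3 := ibp h6 (hasWeakDeriv_magneticResultant x) b3
  have e : P.operatorEB x = applyEB x := rfl
  rw [EnergySpace.inner_eq_energyInner, EnergySpace.energyInner_eq, e]
  have e1 : (applyEB x).x₁ = x.1.x₄ := rfl
  have e2 : (applyEB x).x₂ = x.1.x₅ := rfl
  have e3 : (applyEB x).x₃ = x.1.x₆ := rfl
  rw [e1, e2, e3]
  simp only [normalForce, bendingMoment, magneticResultant, inner_add_left, inner_sub_left,
    inner_add_right, inner_sub_right, real_inner_smul_left, real_inner_smul_right] at i1 i2 i3
  linear_combination i1 + i2 + i3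

/-- Cramer's rule for the symmetric matrix with diagonal `a`, `c` and off-diagonal entry `-b`, with
vectors as unknowns. -/
theorem eq_and_eq_of_smul_sub_smul {E : Type*} [AddCommGroup E] [Module ℝ E] {a b c : ℝ}
    (hd : a * c - b ^ 2 ≠ 0) {u v p q : E} (h1 : a • u - b • v = a • p - b • q)
    (h2 : c • v - b • u = c • q - b • p) : u = p ∧ v = q := by
  constructor
  · refine smul_right_injective E hd ?_
    change (a * c - b ^ 2) • u = (a * c - b ^ 2) • p
    linear_combination (norm := module) c • h1 + b • h2
  · refine smul_right_injective E hd ?_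
    change (a * c - b ^ 2) • v = (a * c - b ^ 2) • q
    linear_combination (norm := module) b • h1 + a • h2

theorem operatorEB_surjective : Function.Surjective P.operatorEB := by
  intro f
  have hr : (1 : ℝ) ∈ Icc (0 : ℝ) 1 := right_mem_Icc.2 zero_le_one
  have hD := P.C_det_pos.ne'
  have hD' : P.CI * P.CA - P.CI0 ^ 2 ≠ 0 := by rwa [mul_comm]
  have hμ := P.μ_pos.ne'
  have hA := P.Ap_pos.ne'
  have hε := P.ε_pos.ne'
  -- `F`, `G`, `K` are the resultants that the solution must have: their derivatives are prescribed
  -- by `f`, and they vanish at `1`.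
  let F := L2I.primitive hr (P.ρA • f.x₄ - P.ρI0 • f.x₅)
  let G := L2I.primitive hr (P.ρI • f.x₅ - P.ρI0 • f.x₄)
  let K := L2I.primitive hr ((P.ε * P.Ap) • f.x₆
      + (P.γ * P.Ap) • weakDeriv f.x₁ - (P.γ * P.I0p) • weakDeriv f.x₂)
  -- Removing the piezoelectric contribution of `x₆ = f.x₃` leaves the system `C_A x₁' - C_{I_0} x₂'
  -- = p`, `C_I x₂' - C_{I_0} x₁' = q` of determinant `D`, which the witness `x` below solves.
  let p := F + (P.γ * P.Ap) • f.x₃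
  let q := G - (P.γ * P.I0p) • f.x₃
  let D := P.CA * P.CI - P.CI0 ^ 2
  have hF : F ∈ H1 := L2I.primitive_mem_H1 hr _
  have hG : G ∈ H1 := L2I.primitive_mem_H1 hr _
  have hK : K ∈ H1 := L2I.primitive_mem_H1 hr _
  have hp : p ∈ H1 := H1.add_mem hF (H1.smul_mem _ f.x₃_mem.1)
  have hq : q ∈ H1 := H1.sub_mem hG (H1.smul_mem _ f.x₃_mem.1)
  let x : EnergySpace P := EnergySpace.mk
    (weakDerivEquiv.symm ((P.CI / D) • p + (P.CI0 / D) • q))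
    (weakDerivEquiv.symm ((P.CI0 / D) • p + (P.CA / D) • q))
    (weakDerivEquiv.symm ((P.μ / P.Ap) • K)) f.x₁ f.x₂ f.x₃
  have w1 : weakDeriv x.x₁ = (P.CI / D) • p + (P.CI0 / D) • q := weakDeriv_weakDerivEquiv_symm _
  have w2 : weakDeriv x.x₂ = (P.CI0 / D) • p + (P.CA / D) • q := weakDeriv_weakDerivEquiv_symm _
  have w3 : weakDeriv x.x₃ = (P.μ / P.Ap) • K := weakDeriv_weakDerivEquiv_symm _
  have e1 : normalForce x = F := by
    unfold normalForce
    rw [w1, w2, show x.x₆ = f.x₃ from rfl]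
    match_scalars <;> simp only [D] <;> field_simp <;> ring
  have e2 : bendingMoment x = G := by
    unfold bendingMoment
    rw [w1, w2, show x.x₆ = f.x₃ from rfl]
    match_scalars <;> simp only [D] <;> field_simp <;> ring
  have e3 : magneticResultant x = K := by
    unfold magneticResultant
    rw [w3]
    match_scalars
    field_simp
  have hx : x ∈ P.domainEB := by
    refine ⟨⟨?_, ?_, ?_⟩, ⟨f.x₁_mem, f.x₂_mem, f.x₃_mem⟩, ?_, ?_, ?_⟩
    · rw [w1]
      exact H1.add_mem (H1.smul_mem _ hp) (H1.smul_mem _ hq)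
    · rw [w2]
      exact H1.add_mem (H1.smul_mem _ hp) (H1.smul_mem _ hq)
    · rw [w3]
      exact H1.smul_mem _ hK
    · change HasValueAt (normalForce x) 1 0
      rw [e1]
      exact L2I.hasValueAt_primitive hr _
    · change HasValueAt (bendingMoment x) 1 0
      rw [e2]
      exact L2I.hasValueAt_primitive hr _
    · change HasValueAt (magneticResultant x) 1 0
      rw [e3]
      exact L2I.hasValueAt_primitive hr _
  have d1 := hasWeakDeriv_normalForce ⟨x, hx⟩
  have d2 := hasWeakDeriv_bendingMoment ⟨x, hx⟩
  have d3 := hasWeakDeriv_magneticResultant ⟨x, hx⟩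
  rw [e1] at d1
  rw [e2] at d2
  rw [e3] at d3
  -- Uniqueness of weak derivatives equates the mass matrix applied to the fourth and fifth
  -- components of `A x` and of `f`; the determinant `Δ` is nonzero.
  obtain ⟨y4, y5⟩ := eq_and_eq_of_smul_sub_smul P.Δ_pos.ne'
    (d1.unique (L2I.hasWeakDeriv_primitive hr _)) (d2.unique (L2I.hasWeakDeriv_primitive hr _))
  have y6 := d3.unique (L2I.hasWeakDeriv_primitive hr _)
  rw [show x.x₄ = f.x₁ from rfl, show x.x₅ = f.x₂ from rfl, sub_left_inj, add_left_inj] at y6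
  exact ⟨⟨x, hx⟩, EnergySpace.ext' rfl rfl rfl y4 y5
    (smul_right_injective L2I (mul_ne_zero hε hA) y6)⟩

end PiezoComposite

end

/-- The energy space is a Hilbert space, and the operator generates a strongly continuous semigroup
of contractions on it. -/
theorem mainTheorem1 (P : PiezoComposite) :
    CompleteSpace P.EnergySpace ∧
      ∃ T : ℝ≥0 → P.EnergySpace →L[ℝ] P.EnergySpace,
        IsC0Semigroup T ∧ IsGenerator P.operatorEB T ∧ ∀ t, ‖T t‖ ≤ 1 :=
  ⟨inferInstance, LinearPMap.exists_contractionSemigroup_of_skew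
    PiezoComposite.inner_operatorEB_self PiezoComposite.operatorEB_surjective⟩
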